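/- Let $\mathbb F$ be an arbitrary field. Algebras are $\mathbb F$-algebras, not necessarily associative or unital. Let $\mathcal R$ be the variety of algebras defined by the identities $$[[a,b],c]=0,\qquad (ab)a=0,\qquad (ab)(cd)=0,$$ where $[a,b]=ab-ba$, and let $F(X)$ be the free algebra of $\mathcal R$ on a countably infinite set $X=\{x_1,x_2,\ldots\}$. For $x,y$ in an algebra $A$ let $V_{x,y}$ be the linear operator $w\mapsto (xw)y$ on $A$; operators are written on the right of their arguments and composed from left to right. Let $E_0$ be the associative algebra (without identity) of operators on $F(X)$ generated by all $V_{x_i,x_j}$ with $i<j$. An element of $E_0$ has degree at most $d$ if it is a linear combination of products $V_{x_{i_1},x_{j_1}}\cdots V_{x_{i_k},x_{j_k}}$ with $k\ge 1$, $i_r<j_r$ and $2k\le d$ (degree in the variables $x_i$). For $n\ge 1$ let $P_n\in\mathcal R$ be the algebra with linear basis $a_{ij},b_{ij},c_i,d_{ij},e_{ij}$ $(1\le i,j\le n)$ and products $$a_{ij}c_i=d_{ij},\quad b_{ij}c_i=e_{ij},\quad a_{ij}e_{ij}=e_{ij}a_{ij}=-b_{ij}d_{ij}=-d_{ij}b_{ij}=c_j,$$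 all other products of basis elements being zero. Let $T=T(E_0(P_n))$ be the ideal of $V$-identities of $P_n$ in $E_0$: the set of all $f=f(x_1,\ldots,x_m)\in E_0$ such that, for all $p_1,\ldots,p_m\in P_n$, the operator $f(p_1,\ldots,p_m)$ on $P_n$ is zero; equivalently, $\varphi(wf)=0$ for every homomorphism $\varphi:F(X)\to P_n$ and every $w\in F(X)$. Proposition. Let $n\ge 2$. If $P_n$ has a finite basis of identities (that is, there is a finite set of identities of $P_n$ of which all identities of $P_n$ are consequences), then $T$ is generated, as a two-sided ideal of the algebra $E_0$, by polynomials of bounded degree: there are a number $d$ and a set $G\subseteq E_0$ of elements of degree at most $d$ such that $T$ is the ideal generated by $G$. -/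

import Mathlib

noncomputable section

namespace MetabelianRS

universe u v

section FreeAlgebras

variable (F : Type u) [Field F]

/-- The absolutely free (non-associative, non-unital) algebra over `F` on the countable set of
generators `x 0, x 1, x 2, …`. -/
abbrev Free : Type u := FreeNonUnitalNonAssocAlgebra F ℕ

variable {F}

/-- A T-ideal: a two-sided ideal of the algebra `Free F` that is closed under all of its
endomorphisms. -/
structure IsTIdeal (I : Submodule F (Free F)) : Prop where
  mul_left : ∀ a x : Free F, x ∈ I → a * x ∈ I
  mul_right : ∀ a x : Free F, x ∈ I → x * a ∈ I
  endo : ∀ (φ : Free F →ₙₐ[F] Free F) (x : Free F), x ∈ I → φ x ∈ I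

/-- The T-ideal generated by `S`: the set of all consequences of the identities `s = 0`,
`s ∈ S`. -/
def tIdeal (S : Set (Free F)) : Submodule F (Free F) :=
  sInf {I | IsTIdeal I ∧ S ⊆ I}

theorem isTIdeal_tIdeal (S : Set (Free F)) : IsTIdeal (tIdeal S) := by
  refine ⟨?_, ?_, ?_⟩
  · intro a x hx
    refine Submodule.mem_sInf.2 fun I hI => ?_
    exact hI.1.mul_left a x (Submodule.mem_sInf.1 hx I hI)
  · intro a x hx
    refine Submodule.mem_sInf.2 fun I hI => ?_
    exact hI.1.mul_right a x (Submodule.mem_sInf.1 hx I hI)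
  · intro φ x hx
    refine Submodule.mem_sInf.2 fun I hI => ?_
    exact hI.1.endo φ x (Submodule.mem_sInf.1 hx I hI)

/-- The relatively free algebra, of countable rank, of the variety defined by the identities
`s = 0`, `s ∈ S`. -/
def RelFree (S : Set (Free F)) : Type u := Free F ⧸ tIdeal S

namespace RelFree

variable (S : Set (Free F))

instance : AddCommGroup (RelFree S) := inferInstanceAs (AddCommGroup (Free F ⧸ tIdeal S))

instance : Module F (RelFree S) := inferInstanceAs (Module F (Free F ⧸ tIdeal S))

/-- The quotient map, as a linear map. -/
def proj : Free F →ₗ[F] RelFree S := (tIdeal S).mkQ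

theorem proj_surjective : Function.Surjective (proj S) := (tIdeal S).mkQ_surjective

theorem proj_eq_zero {a : Free F} : proj S a = 0 ↔ a ∈ tIdeal S :=
  Submodule.Quotient.mk_eq_zero (tIdeal S)

/-- Multiplication of the quotient algebra, as a bilinear map. -/
def mulHom : RelFree S →ₗ[F] RelFree S →ₗ[F] RelFree S :=
  (tIdeal S).liftQ
    { toFun := fun a => (tIdeal S).liftQ ((proj S).comp (LinearMap.mulLeft F a)) (by
        intro x hx
        exact (proj_eq_zero S).2 ((isTIdeal_tIdeal S).mul_left a x hx))
      map_add' := fun a b => by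
        refine LinearMap.ext fun y => ?_
        obtain ⟨y, rfl⟩ := (tIdeal S).mkQ_surjective y
        change proj S ((a + b) * y) = proj S (a * y) + proj S (b * y)
        rw [add_mul, map_add]
      map_smul' := fun r a => by
        refine LinearMap.ext fun y => ?_
        obtain ⟨y, rfl⟩ := (tIdeal S).mkQ_surjective y
        change proj S ((r • a) * y) = r • proj S (a * y)
        rw [smul_mul_assoc, map_smul] }
    (by
      intro a ha
      refine LinearMap.ext fun y => ?_
      obtain ⟨y, rfl⟩ := (tIdeal S).mkQ_surjective y
      exact (proj_eq_zero S).2 ((isTIdeal_tIdeal S).mul_right y a ha))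

instance : Mul (RelFree S) := ⟨fun a b => mulHom S a b⟩

theorem mul_def (a b : RelFree S) : a * b = mulHom S a b := rfl

theorem proj_mul (a b : Free F) : proj S (a * b) = proj S a * proj S b := rfl

instance : NonUnitalNonAssocRing (RelFree S) :=
  { (inferInstance : AddCommGroup (RelFree S)), (inferInstance : Mul (RelFree S)) with
    left_distrib := fun a b c => by simp only [mul_def, map_add]
    right_distrib := fun a b c => by simp only [mul_def, map_add, LinearMap.add_apply]
    zero_mul := fun a => by simp only [mul_def, map_zero, LinearMap.zero_apply]
    mul_zero := fun a => by simp only [mul_def, map_zero] }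

instance : IsScalarTower F (RelFree S) (RelFree S) :=
  ⟨fun r a b => by simp only [smul_eq_mul, mul_def, map_smul, LinearMap.smul_apply]⟩

instance : SMulCommClass F (RelFree S) (RelFree S) :=
  ⟨fun r a b => by simp only [smul_eq_mul, mul_def, map_smul]⟩

/-- The free generator `x i` of the relatively free algebra. -/
def gen (i : ℕ) : RelFree S := proj S (FreeNonUnitalNonAssocAlgebra.of F i)

end RelFree

end FreeAlgebras

section Identities

variable (F : Type u) [Field F]

/-- The identities of an algebra `B`: all `f` vanishing under every substitution of elements of
`B` for the variables, that is, under every homomorphism from the absolutely free algebra. -/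
def identities (B : Type v) [NonUnitalNonAssocRing B] [Module F B] :
    Submodule F (Free F) where
  carrier := {f | ∀ φ : Free F →ₙₐ[F] B, φ f = 0}
  add_mem' := fun {f g} hf hg φ => by rw [map_add, hf φ, hg φ, add_zero]
  zero_mem' := fun φ => map_zero φ
  smul_mem' := fun r f hf φ => by rw [map_smul, hf φ, smul_zero]

/-- `B` has a finite basis of identities: all identities of `B` are consequences of a finite set
of identities of `B`. -/
def HasFiniteBasis (B : Type v) [NonUnitalNonAssocRing B] [Module F B] : Prop :=
  ∃ S : Set (Free F), S.Finite ∧ tIdeal S = identities F B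

/-- The defining identities of the variety `R`, for variables `a, b, c, d`:
`[[a, b], c] = 0`, `(a b) a = 0` and `(a b) (c d) = 0`. -/
def definingIdentities : Set (Free F) :=
  let a : Free F := FreeNonUnitalNonAssocAlgebra.of F 0
  let b : Free F := FreeNonUnitalNonAssocAlgebra.of F 1
  let c : Free F := FreeNonUnitalNonAssocAlgebra.of F 2
  let d : Free F := FreeNonUnitalNonAssocAlgebra.of F 3
  {(a * b - b * a) * c - c * (a * b - b * a), (a * b) * a, (a * b) * (c * d)}

/-- The free algebra `F(X)` of the variety `R` on the countable set `X = {x 0, x 1, …}`. -/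
abbrev FX : Type u := RelFree (definingIdentities F)

end Identities

section Operators

variable (F : Type u) [Field F]

/-- The associative algebra of linear operators on `F(X)` written on the right of their argument:
in a product `S * T` the operator `S` acts first. -/
abbrev RightOp : Type u := (Module.End F (FX F))ᵐᵒᵖ

/-- The operator `V_{x, y} = L_x R_y`, that is, `w ↦ (x w) y`. -/
def V (x y : FX F) : RightOp F :=
  MulOpposite.op (LinearMap.mulLeft F x) * MulOpposite.op (LinearMap.mulRight F y)

theorem V_apply (x y w : FX F) : (V F x y).unop w = (x * w) * y := rfl

/-- The operator `V_{x i, x j}` of two generators of `F(X)`. -/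
def Vgen (p : ℕ × ℕ) : RightOp F :=
  V F (RelFree.gen (definingIdentities F) p.1) (RelFree.gen (definingIdentities F) p.2)

/-- The associative algebra `E₀` without identity generated by all `V_{x i, x j}` with `i < j`. -/
def E0 : NonUnitalSubalgebra F (RightOp F) :=
  NonUnitalAlgebra.adjoin F (Vgen F '' {p | p.1 < p.2})

variable {F}

/-- `f ∈ E₀` is a polynomial of degree at most `d` in the variables `x 0, x 1, …`: it is a linear
combination of words `V_{x i₁, x j₁} ⋯ V_{x iₖ, x jₖ}` with `1 ≤ k` and `2 k ≤ d`. -/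
def DegreeLE (d : ℕ) (f : E0 F) : Prop :=
  (f : RightOp F) ∈ Submodule.span F
    {w : RightOp F | ∃ l : List (ℕ × ℕ),
      l ≠ [] ∧ (∀ p ∈ l, p.1 < p.2) ∧ 2 * l.length ≤ d ∧ w = (l.map (Vgen F)).prod}

/-- The (two-sided, `F`-linear) ideal of the algebra `E₀` generated by a set `G`. -/
def idealSpan (G : Set (E0 F)) : Submodule F (E0 F) :=
  sInf {I | G ⊆ I ∧ ∀ u f : E0 F, f ∈ I → u * f ∈ I ∧ f * u ∈ I}

variable (F)

/-- The ideal `T(E₀(B))` of `V`-identities of the algebra `B`. A homomorphism `φ : F(X) → B`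
induces the action `φ(w) ↦ φ(w f) = φ(w) f(φ(x 0), φ(x 1), …)` of `f ∈ E₀` on the image of `φ`;
`T(E₀(B))` is the intersection of the kernels of these actions over all `φ`. As the variables of
`f` are finite in number and `w` may be any other variable, this says for `B` in the variety that
`f(b₀, b₁, …)` is the zero operator on all of `B`, for all `b₀, b₁, … ∈ B`. -/
def vIdentities (B : Type v) [NonUnitalNonAssocRing B] [Module F B] : Submodule F (E0 F) where
  carrier := {f | ∀ (φ : FX F →ₙₐ[F] B) (w : FX F), φ ((f : RightOp F).unop w) = 0}
  add_mem' := fun {f g} hf hg φ w => by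
    change φ ((f : RightOp F).unop w + (g : RightOp F).unop w) = 0
    rw [map_add, hf φ w, hg φ w, add_zero]
  zero_mem' := fun φ w => map_zero φ
  smul_mem' := fun r f hf φ w => by
    change φ (r • (f : RightOp F).unop w) = 0
    rw [map_smul, hf φ w, smul_zero]

end Operators

section AlgebraP

/-- Labels of the basis of `P_n`: `a i j`, `b i j`, `c i`, `d i j`, `e i j`. -/
inductive Idx (n : ℕ) : Type
  | a (i j : Fin n) : Idx n
  | b (i j : Fin n) : Idx n
  | c (i : Fin n) : Idx n
  | d (i j : Fin n) : Idx n
  | e (i j : Fin n) : Idx n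

variable (F : Type u) [Field F] (n : ℕ)

/-- The products of basis elements of `P_n`. -/
def table : Idx n → Idx n → (Idx n →₀ F)
  | .a i j, .c k => if i = k then Finsupp.single (.d i j) 1 else 0
  | .b i j, .c k => if i = k then Finsupp.single (.e i j) 1 else 0
  | .a i j, .e k l => if i = k ∧ j = l then Finsupp.single (.c j) 1 else 0
  | .e k l, .a i j => if i = k ∧ j = l then Finsupp.single (.c j) 1 else 0
  | .b i j, .d k l => if i = k ∧ j = l then -Finsupp.single (.c j) 1 else 0
  | .d k l, .b i j => if i = k ∧ j = l then -Finsupp.single (.c j) 1 else 0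
  | _, _ => 0

/-- The bilinear extension of the multiplication table. -/
def mulHomP : (Idx n →₀ F) →ₗ[F] (Idx n →₀ F) →ₗ[F] (Idx n →₀ F) :=
  Finsupp.linearCombination F fun x => Finsupp.linearCombination F fun y => table F n x y

/-- The algebra `P_n` over `F`. -/
def P : Type u := Idx n →₀ F

namespace P

instance : AddCommGroup (P F n) := inferInstanceAs (AddCommGroup (Idx n →₀ F))

instance : Module F (P F n) := inferInstanceAs (Module F (Idx n →₀ F))

instance : Mul (P F n) := ⟨fun x y => mulHomP F n x y⟩

theorem mul_def (x y : P F n) : x * y = mulHomP F n x y := rfl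

instance : NonUnitalNonAssocRing (P F n) :=
  { (inferInstance : AddCommGroup (P F n)), (inferInstance : Mul (P F n)) with
    left_distrib := fun x y z => (mulHomP F n x).map_add y z
    right_distrib := fun x y z => (mulHomP F n).map_add₂ x y z
    zero_mul := fun x => (mulHomP F n).map_zero₂ x
    mul_zero := fun x => (mulHomP F n x).map_zero }

instance : IsScalarTower F (P F n) (P F n) :=
  ⟨fun r x y => (mulHomP F n).map_smul₂ r x y⟩

instance : SMulCommClass F (P F n) (P F n) :=
  ⟨fun r x y => ((mulHomP F n x).map_smul r y).symm⟩

end P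

end AlgebraP

end MetabelianRS

end

noncomputable section

namespace MetabelianRS

universe u v w

open scoped TensorProduct

/-! ### T-ideals, algebras of the variety, and homomorphisms out of F(X). -/

section FreeAlgebra

variable {F : Type u} [Field F]

/-! The identities of $P_n$ are tested on an auxiliary algebra of the variety in which the operators
of $E_0$ are visible as elements. Let $A$ be $E_0$ with the identity operator adjoined (`E1`), $X$
the space of linear forms in the generators and $v(x,y)=V_{x,y}$ (`vForm`). The algebra `Model` is
$X\oplus A\oplus X\otimes A$, with $x\cdot m=x\otimes m$ and $y(x\otimes m)=(x\otimes
m)y=m\,v(x,y)$. It lies in the variety because $v$ is alternating, and a suitable ideal of $A$ gives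
an ideal of it (`Model.ideal`).

Any homomorphism $\psi:F(X)\to P_n$ and any $w$ give a homomorphism `Model` $\to P_n$ (`evalModel`),
because $V_{x,y}$ acts on $P_n$ through the $a,b$-coordinates of $x,y$ and the $c$-coordinates of
the argument. So every value in `Model` of an identity $s$ of $P_n$ has components that vanish on
$P_n$, that is, $V$-identities. Values are left $A$-linear in the components outside $X$, so it is
enough to substitute $1$ and $x\otimes 1$ there, and then the degree of the value is bounded in
terms of $s$ alone. Hence all values of $s$ lie in the ideal given by the $V$-identities of some
bounded degree (`exists_bound_map_mem_ideal`).

For a finite basis one degree $d$ serves all its members, and then all their consequences. If $f\in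
T$, then $x_0f$ lifts to an identity of $P_n$; its value under $x_i\mapsto x_i+1$ has $A$-component
$f$, so $f$ lies in the ideal generated by the $V$-identities of degree at most $d$
(`vIdentities_le_idealSpan`). -/

theorem free_induction {p : Free F → Prop}
    (of : ∀ i, p (FreeNonUnitalNonAssocAlgebra.of F i))
    (add : ∀ x y, p x → p y → p (x + y)) (zero : p 0)
    (mul : ∀ x y, p x → p y → p (x * y))
    (smul : ∀ (r : F) x, p x → p (r • x)) (x : Free F) : p x := by
  let A : NonUnitalSubalgebra F (Free F) :=
    { carrier := {x | p x}
      add_mem' := fun {x y} hx hy => add x y hx hy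
      zero_mem' := zero
      mul_mem' := fun {x y} hx hy => mul x y hx hy
      smul_mem' := fun r x hx => smul r x hx }
  let g : Free F →ₙₐ[F] A :=
    FreeNonUnitalNonAssocAlgebra.lift F fun i => ⟨FreeNonUnitalNonAssocAlgebra.of F i, of i⟩
  have h : (NonUnitalSubalgebraClass.subtype A).comp g = NonUnitalAlgHom.id F (Free F) := by
    apply FreeNonUnitalNonAssocAlgebra.hom_ext
    intro i
    simp [g]
  have hx : ((g x : A) : Free F) = x := DFunLike.congr_fun h x
  rw [← hx]
  exact (g x).2

/-- An algebra of the variety `R`. -/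
structure InVariety (B : Type v) [NonUnitalNonAssocRing B] : Prop where
  comm : ∀ a b c : B, (a * b - b * a) * c - c * (a * b - b * a) = 0
  flex : ∀ a b : B, (a * b) * a = 0
  metab : ∀ a b c d : B, (a * b) * (c * d) = 0

variable {B : Type v} [NonUnitalNonAssocRing B] [Module F B]

/-- The elements sent into the ideal `J` by all homomorphisms to `B` form a T-ideal. -/
theorem isTIdeal_of_ideal (J : Submodule F B)
    (hl : ∀ a x, x ∈ J → a * x ∈ J) (hr : ∀ a x, x ∈ J → x * a ∈ J) :
    ∃ I : Submodule F (Free F), IsTIdeal I ∧ ∀ g, g ∈ I ↔ ∀ φ : Free F →ₙₐ[F] B, φ g ∈ J := by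
  refine ⟨{ carrier := {g | ∀ φ : Free F →ₙₐ[F] B, φ g ∈ J}
            add_mem' := fun {f g} hf hg φ => ?_
            zero_mem' := fun φ => ?_
            smul_mem' := fun r f hf φ => ?_ }, ⟨?_, ?_, ?_⟩, fun g => Iff.rfl⟩
  · rw [map_add]; exact J.add_mem (hf φ) (hg φ)
  · rw [map_zero]; exact J.zero_mem
  · rw [map_smul]; exact J.smul_mem r (hf φ)
  · intro a x hx φ
    rw [map_mul]; exact hl _ _ (hx φ)
  · intro a x hx φ
    rw [map_mul]; exact hr _ _ (hx φ)
  · intro θ x hx φ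
    exact hx (φ.comp θ)

/-- Membership in an ideal passes from identities to their consequences. With `J = ⊥` it yields the
factorization through F(X); with an ideal of the model algebra it carries the degree bound from a
basis to all identities. -/
theorem map_mem_of_mem_tIdeal {S : Set (Free F)} (J : Submodule F B)
    (hl : ∀ a x, x ∈ J → a * x ∈ J) (hr : ∀ a x, x ∈ J → x * a ∈ J)
    (hS : ∀ s ∈ S, ∀ φ : Free F →ₙₐ[F] B, φ s ∈ J) {g : Free F} (hg : g ∈ tIdeal S)
    (φ : Free F →ₙₐ[F] B) : φ g ∈ J := by
  obtain ⟨I, hI, hmem⟩ := isTIdeal_of_ideal J hl hr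
  exact (hmem g).1 (Submodule.mem_sInf.1 hg I ⟨hI, fun s hs => (hmem s).2 (hS s hs)⟩) φ

theorem InVariety.map_eq_zero (hB : InVariety B) {g : Free F}
    (hg : g ∈ tIdeal (definingIdentities F)) (φ : Free F →ₙₐ[F] B) : φ g = 0 := by
  refine (Submodule.mem_bot F).1 (map_mem_of_mem_tIdeal ⊥ ?_ ?_ ?_ hg φ)
  · intro a x hx
    rw [(Submodule.mem_bot F).1 hx, mul_zero]; exact zero_mem _
  · intro a x hx
    rw [(Submodule.mem_bot F).1 hx, zero_mul]; exact zero_mem _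
  · intro s hs φ
    rw [Submodule.mem_bot]
    rcases hs with rfl | rfl | rfl
    · simpa using hB.comm _ _ _
    · simpa using hB.flex _ _
    · simpa using hB.metab _ _ _ _

/-- A homomorphism from the absolutely free algebra to an algebra of the variety factors
through `F(X)`. -/
def descend (hB : InVariety B) (φ : Free F →ₙₐ[F] B) : FX F →ₙₐ[F] B where
  toFun := (tIdeal (definingIdentities F)).liftQ (φ : Free F →ₗ[F] B)
    fun _ hg => hB.map_eq_zero hg φ
  map_smul' := fun r x => LinearMap.map_smul _ r x
  map_zero' := LinearMap.map_zero _
  map_add' := fun x y => LinearMap.map_add _ x y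
  map_mul' := fun x y => by
    obtain ⟨x, rfl⟩ := RelFree.proj_surjective _ x
    obtain ⟨y, rfl⟩ := RelFree.proj_surjective _ y
    exact map_mul φ x y

theorem descend_proj (hB : InVariety B) (φ : Free F →ₙₐ[F] B) (g : Free F) :
    descend hB φ (RelFree.proj _ g) = φ g := rfl

theorem descend_gen (hB : InVariety B) (φ : Free F →ₙₐ[F] B) (i : ℕ) :
    descend hB φ (RelFree.gen _ i) = φ (FreeNonUnitalNonAssocAlgebra.of F i) := rfl

theorem FX_flex (x y : FX F) : (x * y) * x = 0 := by
  obtain ⟨x, rfl⟩ := RelFree.proj_surjective _ x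
  obtain ⟨y, rfl⟩ := RelFree.proj_surjective _ y
  rw [← RelFree.proj_mul, ← RelFree.proj_mul, RelFree.proj_eq_zero]
  let φ : Free F →ₙₐ[F] Free F :=
    FreeNonUnitalNonAssocAlgebra.lift F fun i => if i = 0 then x else y
  have h := (isTIdeal_tIdeal (definingIdentities F)).endo φ
    ((FreeNonUnitalNonAssocAlgebra.of F 0 * FreeNonUnitalNonAssocAlgebra.of F 1) *
      FreeNonUnitalNonAssocAlgebra.of F 0)
    (Submodule.mem_sInf.2 fun I hI => hI.2 (by simp [definingIdentities]))
  simpa [φ] using h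

/-- This is the identity $(ab)a=0$ read as a statement on operators; it makes $V$ alternating. -/
theorem V_self (x : FX F) : V F x x = 0 := by
  apply MulOpposite.unop_injective
  refine LinearMap.ext fun w => ?_
  exact FX_flex x w

end FreeAlgebra

/-! ### Coordinates of products in P_n. -/

section AlgebraP

variable {F : Type u} [Field F] {n : ℕ}

namespace P

/-- The coordinate of an element of `P_n` at a basis element. -/
def coord (k : Idx n) : P F n →ₗ[F] F := Finsupp.lapply k

/-- The basis element of `P_n` with a given label. -/
def basis (k : Idx n) : P F n := Finsupp.single k (1 : F)

theorem ext_coord {x y : P F n} (h : ∀ k, coord k x = coord k y) : x = y :=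
  Finsupp.ext h

theorem coord_basis_self (k : Idx n) : coord k (basis k : P F n) = 1 :=
  Finsupp.single_eq_same

theorem coord_basis_of_ne {k l : Idx n} (h : k ≠ l) : coord k (basis l : P F n) = 0 :=
  Finsupp.single_eq_of_ne h

theorem linearMap_ext {M : Type w} [AddCommGroup M] [Module F M] {f g : P F n →ₗ[F] M}
    (h : ∀ k, f (basis k) = g (basis k)) : f = g :=
  Finsupp.lhom_ext' fun k => LinearMap.ext_ring (h k)

theorem basis_mul_basis (k l : Idx n) : (basis k * basis l : P F n) = table F n k l := by
  rw [mul_def, mulHomP, basis, basis, Finsupp.linearCombination_single, one_smul,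
    Finsupp.linearCombination_single, one_smul]

theorem bilin_ext {M : Type w} [AddCommGroup M] [Module F M] {f g : P F n →ₗ[F] P F n →ₗ[F] M}
    (h : ∀ k l, f (basis k) (basis l) = g (basis k) (basis l)) : f = g :=
  linearMap_ext fun k => linearMap_ext (h k)

theorem coord_mul_a (x y : P F n) (i j : Fin n) : coord (.a i j) (x * y) = 0 := by
  have : (LinearMap.mul F (P F n)).compr₂ (coord (.a i j)) = 0 := by
    refine bilin_ext fun k l => ?_
    simp only [LinearMap.compr₂_apply, LinearMap.mul_apply', basis_mul_basis, LinearMap.zero_apply]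
    change (table F n k l) _ = 0
    rcases k <;> rcases l <;> simp only [table] <;> (try split_ifs) <;> simp
  exact LinearMap.congr_fun₂ this x y

theorem coord_mul_b (x y : P F n) (i j : Fin n) : coord (.b i j) (x * y) = 0 := by
  have : (LinearMap.mul F (P F n)).compr₂ (coord (.b i j)) = 0 := by
    refine bilin_ext fun k l => ?_
    simp only [LinearMap.compr₂_apply, LinearMap.mul_apply', basis_mul_basis, LinearMap.zero_apply]
    change (table F n k l) _ = 0
    rcases k <;> rcases l <;> simp only [table] <;> (try split_ifs) <;> simp
  exact LinearMap.congr_fun₂ this x y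

/-- The bilinear form `(x, y) ↦ x_k y_l`. -/
def form (k l : Idx n) : P F n →ₗ[F] P F n →ₗ[F] F :=
  (LinearMap.mul F F).compl₁₂ (coord k) (coord l)

theorem form_apply (k l : Idx n) (x y : P F n) : form k l x y = coord k x * coord l y := rfl

theorem coord_mul_d (x y : P F n) (i j : Fin n) :
    coord (.d i j) (x * y) = coord (.a i j) x * coord (.c i) y := by
  have : (LinearMap.mul F (P F n)).compr₂ (coord (.d i j)) = form (.a i j) (.c i) := by
    classical
    refine bilin_ext fun k l => ?_
    simp only [LinearMap.compr₂_apply, LinearMap.mul_apply', basis_mul_basis, form_apply]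
    change (table F n k l) _ = Finsupp.single _ _ _ * Finsupp.single _ _ _
    rcases k <;> rcases l <;> simp only [table, Finsupp.single_apply] <;> (try split_ifs) <;>
      simp_all
  exact LinearMap.congr_fun₂ this x y

theorem coord_mul_e (x y : P F n) (i j : Fin n) :
    coord (.e i j) (x * y) = coord (.b i j) x * coord (.c i) y := by
  have : (LinearMap.mul F (P F n)).compr₂ (coord (.e i j)) = form (.b i j) (.c i) := by
    classical
    refine bilin_ext fun k l => ?_
    simp only [LinearMap.compr₂_apply, LinearMap.mul_apply', basis_mul_basis, form_apply]
    change (table F n k l) _ = Finsupp.single _ _ _ * Finsupp.single _ _ _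
    rcases k <;> rcases l <;> simp only [table, Finsupp.single_apply] <;> (try split_ifs) <;>
      simp_all
  exact LinearMap.congr_fun₂ this x y

theorem coord_mul_c (x y : P F n) (j : Fin n) :
    coord (.c j) (x * y) = ∑ i, (coord (.a i j) x * coord (.e i j) y
      + coord (.e i j) x * coord (.a i j) y - coord (.b i j) x * coord (.d i j) y
      - coord (.d i j) x * coord (.b i j) y) := by
  have : (LinearMap.mul F (P F n)).compr₂ (coord (.c j)) =
      ∑ i, (form (.a i j) (.e i j) + form (.e i j) (.a i j) - form (.b i j) (.d i j)
        - form (.d i j) (.b i j)) := by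
    classical
    refine bilin_ext fun k l => ?_
    simp only [LinearMap.compr₂_apply, LinearMap.mul_apply', basis_mul_basis, LinearMap.sum_apply,
      LinearMap.add_apply, LinearMap.sub_apply, form_apply]
    change (table F n k l) _ = ∑ i, (Finsupp.single _ _ _ * Finsupp.single _ _ _ +
      Finsupp.single _ _ _ * Finsupp.single _ _ _ - Finsupp.single _ _ _ * Finsupp.single _ _ _ -
      Finsupp.single _ _ _ * Finsupp.single _ _ _)
    rcases k with ⟨k, k'⟩ | ⟨k, k'⟩ | k | ⟨k, k'⟩ | ⟨k, k'⟩ <;>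
    rcases l with ⟨l, l'⟩ | ⟨l, l'⟩ | l | ⟨l, l'⟩ | ⟨l, l'⟩ <;>
      simp only [table, Finsupp.single_apply, reduceCtorEq, if_false, mul_zero, zero_mul,
        Finset.sum_const_zero, add_zero, zero_add, sub_zero, zero_sub, Finsupp.coe_zero,
        Pi.zero_apply, Idx.a.injEq, Idx.b.injEq, Idx.d.injEq, Idx.e.injEq, ite_and,
        Finset.sum_neg_distrib, ite_mul, one_mul, Finset.sum_ite_eq,
        Finset.mem_univ, if_true] <;>
      split_ifs <;> simp_all
  have h := LinearMap.congr_fun₂ this x y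
  simpa [form_apply, LinearMap.sum_apply] using h

end P

end AlgebraP

/-! ### P_n lies in the variety; how the operators V act on it. -/

section AlgebraP

variable {F : Type u} [Field F] {n : ℕ}

namespace P

/-- Products have no $a$- or $b$-coordinates, and elements without them multiply to zero. The
$c$-coordinates of a product are symmetric in its factors, and $(xz)x=0$ because the $a\cdot e$ and
$b\cdot d$ terms cancel. -/
theorem inVariety : InVariety (P F n) where
  comm := fun a b c => by
    refine ext_coord fun k => ?_
    rcases k with ⟨i, j⟩ | ⟨i, j⟩ | j | ⟨i, j⟩ | ⟨i, j⟩
    · simp [coord_mul_a]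
    · simp [coord_mul_b]
    · simp only [map_sub, map_zero, coord_mul_c, coord_mul_a, coord_mul_b]
      rw [← Finset.sum_sub_distrib]
      exact Finset.sum_eq_zero fun i _ => by ring
    · simp only [map_sub, map_zero, coord_mul_d, coord_mul_c, coord_mul_a]
      rw [← Finset.sum_sub_distrib, Finset.sum_eq_zero fun i _ => by ring]
      ring
    · simp only [map_sub, map_zero, coord_mul_e, coord_mul_c, coord_mul_b]
      rw [← Finset.sum_sub_distrib, Finset.sum_eq_zero fun i _ => by ring]
      ring
  flex := fun a b => by
    refine ext_coord fun k => ?_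
    rcases k with ⟨i, j⟩ | ⟨i, j⟩ | j | ⟨i, j⟩ | ⟨i, j⟩
    · simp [coord_mul_a]
    · simp [coord_mul_b]
    · simp only [map_zero, coord_mul_c, coord_mul_a, coord_mul_b, coord_mul_d, coord_mul_e]
      exact Finset.sum_eq_zero fun i _ => by ring
    · simp [coord_mul_d, coord_mul_a]
    · simp [coord_mul_e, coord_mul_b]
  metab := fun a b c d => by
    refine ext_coord fun k => ?_
    rcases k with ⟨i, j⟩ | ⟨i, j⟩ | j | ⟨i, j⟩ | ⟨i, j⟩
    · simp [coord_mul_a]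
    · simp [coord_mul_b]
    · simp [coord_mul_c, coord_mul_a, coord_mul_b]
    · simp [coord_mul_d, coord_mul_a]
    · simp [coord_mul_e, coord_mul_b]

open Classical in
/-- The projection of `P_n` to the span of a set of basis elements. -/
def restrict (s : Set (Idx n)) : P F n →ₗ[F] P F n where
  toFun x := Finsupp.filter (· ∈ s) x
  map_add' _ _ := Finsupp.filter_add
  map_smul' _ _ := Finsupp.filter_smul

open Classical in
theorem coord_restrict (s : Set (Idx n)) (k : Idx n) (x : P F n) :
    coord k (restrict s x) = if k ∈ s then coord k x else 0 :=
  Finsupp.filter_apply (· ∈ s) (show Idx n →₀ F from x) k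

/-- The projection of `P_n` to the span of the `a i j` and the `b i j`. -/
def abPart : P F n →ₗ[F] P F n := restrict {k | (∃ i j, k = .a i j) ∨ ∃ i j, k = .b i j}

/-- The projection of `P_n` to the span of the `c i`. -/
def cPart : P F n →ₗ[F] P F n := restrict {k | ∃ i, k = .c i}

@[simp] theorem coord_abPart_a (i j : Fin n) (x : P F n) :
    coord (.a i j) (abPart x) = coord (.a i j) x := by simp [abPart, coord_restrict]

@[simp] theorem coord_abPart_b (i j : Fin n) (x : P F n) :
    coord (.b i j) (abPart x) = coord (.b i j) x := by simp [abPart, coord_restrict]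

@[simp] theorem coord_abPart_c (i : Fin n) (x : P F n) :
    coord (.c i) (abPart x) = 0 := by simp [abPart, coord_restrict]

@[simp] theorem coord_abPart_d (i j : Fin n) (x : P F n) :
    coord (.d i j) (abPart x) = 0 := by simp [abPart, coord_restrict]

@[simp] theorem coord_abPart_e (i j : Fin n) (x : P F n) :
    coord (.e i j) (abPart x) = 0 := by simp [abPart, coord_restrict]

@[simp] theorem coord_cPart_a (i j : Fin n) (x : P F n) :
    coord (.a i j) (cPart x) = 0 := by simp [cPart, coord_restrict]

@[simp] theorem coord_cPart_b (i j : Fin n) (x : P F n) :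
    coord (.b i j) (cPart x) = 0 := by simp [cPart, coord_restrict]

@[simp] theorem coord_cPart_c (i : Fin n) (x : P F n) :
    coord (.c i) (cPart x) = coord (.c i) x := by simp [cPart, coord_restrict]

@[simp] theorem coord_cPart_d (i j : Fin n) (x : P F n) :
    coord (.d i j) (cPart x) = 0 := by simp [cPart, coord_restrict]

@[simp] theorem coord_cPart_e (i j : Fin n) (x : P F n) :
    coord (.e i j) (cPart x) = 0 := by simp [cPart, coord_restrict]

theorem cPart_mul (x y : P F n) : cPart x * y = 0 := by
  refine ext_coord fun k => ?_
  rcases k with ⟨i, j⟩ | ⟨i, j⟩ | j | ⟨i, j⟩ | ⟨i, j⟩ <;>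
    simp [coord_mul_a, coord_mul_b, coord_mul_c, coord_mul_d, coord_mul_e]

theorem abPart_mul_abPart (x y : P F n) : abPart x * abPart y = 0 := by
  refine ext_coord fun k => ?_
  rcases k with ⟨i, j⟩ | ⟨i, j⟩ | j | ⟨i, j⟩ | ⟨i, j⟩ <;>
    simp [coord_mul_a, coord_mul_b, coord_mul_c, coord_mul_d, coord_mul_e]

theorem mul_mul_cPart (x y z : P F n) : (x * y) * cPart z = 0 := by
  refine ext_coord fun k => ?_
  rcases k with ⟨i, j⟩ | ⟨i, j⟩ | j | ⟨i, j⟩ | ⟨i, j⟩ <;>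
    simp [coord_mul_a, coord_mul_b, coord_mul_c, coord_mul_d, coord_mul_e]

theorem abPart_mul_mul (x y z : P F n) :
    abPart x * (abPart y * cPart z) = (abPart y * cPart z) * abPart x := by
  refine ext_coord fun k => ?_
  rcases k with ⟨i, j⟩ | ⟨i, j⟩ | j | ⟨i, j⟩ | ⟨i, j⟩ <;>
    simp [coord_mul_a, coord_mul_b, coord_mul_c, coord_mul_d, coord_mul_e]
  rw [← Finset.sum_sub_distrib, ← Finset.sum_sub_distrib]
  exact Finset.sum_congr rfl fun i _ => by ring

/-- `P_n` acts on itself by operators `V_{x, y}` through the span of the `c i`. -/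
theorem mul_mul_eq (x y z : P F n) : (x * z) * y = (abPart x * cPart z) * abPart y := by
  refine ext_coord fun k => ?_
  rcases k with ⟨i, j⟩ | ⟨i, j⟩ | j | ⟨i, j⟩ | ⟨i, j⟩ <;>
    simp [coord_mul_a, coord_mul_b, coord_mul_c, coord_mul_d, coord_mul_e]

theorem cPart_mul_mul (x y z : P F n) : cPart ((x * z) * y) = (x * z) * y := by
  refine ext_coord fun k => ?_
  rcases k with ⟨i, j⟩ | ⟨i, j⟩ | j | ⟨i, j⟩ | ⟨i, j⟩ <;>
    simp [coord_mul_a, coord_mul_b, coord_mul_c, coord_mul_d, coord_mul_e]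

theorem abPart_abPart_mul_cPart (x y : P F n) : abPart (abPart x * cPart y) = 0 := by
  refine ext_coord fun k => ?_
  rcases k with ⟨i, j⟩ | ⟨i, j⟩ | j | ⟨i, j⟩ | ⟨i, j⟩ <;>
    simp [coord_mul_a, coord_mul_b]

theorem cPart_abPart_mul_cPart (x y : P F n) : cPart (abPart x * cPart y) = 0 := by
  refine ext_coord fun k => ?_
  rcases k with ⟨i, j⟩ | ⟨i, j⟩ | j | ⟨i, j⟩ | ⟨i, j⟩ <;>
    simp [coord_mul_c]

theorem abPart_cPart (x : P F n) : abPart (cPart x) = 0 := by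
  refine ext_coord fun k => ?_
  rcases k with ⟨i, j⟩ | ⟨i, j⟩ | j | ⟨i, j⟩ | ⟨i, j⟩ <;> simp

theorem cPart_abPart (x : P F n) : cPart (abPart x) = 0 := by
  refine ext_coord fun k => ?_
  rcases k with ⟨i, j⟩ | ⟨i, j⟩ | j | ⟨i, j⟩ | ⟨i, j⟩ <;> simp

theorem abPart_abPart (x : P F n) : abPart (abPart x) = abPart x := by
  refine ext_coord fun k => ?_
  rcases k with ⟨i, j⟩ | ⟨i, j⟩ | j | ⟨i, j⟩ | ⟨i, j⟩ <;> simp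

theorem cPart_cPart (x : P F n) : cPart (cPart x) = cPart x := by
  refine ext_coord fun k => ?_
  rcases k with ⟨i, j⟩ | ⟨i, j⟩ | j | ⟨i, j⟩ | ⟨i, j⟩ <;> simp

end P

end AlgebraP

/-! ### The model algebra built from a bilinear map into an associative algebra. -/

section Model

variable {F : Type u} [Field F] {X : Type v} [AddCommGroup X] [Module F X]
  {A : Type w} [Ring A] [Algebra F A]

/-- The pairing `(y, x ⊗ m) ↦ m * v x y`. -/
def act (v : X →ₗ[F] X →ₗ[F] A) : X →ₗ[F] (X ⊗[F] A) →ₗ[F] A :=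
  LinearMap.mk₂ F (fun y h => TensorProduct.lift ((LinearMap.mul F A).flip ∘ₗ v.flip y) h)
    (fun y y' h => by
      induction h with
      | zero => simp
      | tmul x m => simp
      | add h h' ih ih' =>
        simp only [LinearMap.map_add (TensorProduct.lift _), ih, ih']
        abel)
    (fun r y h => by
      induction h with
      | zero => simp
      | tmul x m => simp
      | add h h' ih ih' => simp only [map_add, ih, ih', smul_add])
    (fun y h h' => map_add _ h h') (fun r y h => map_smul _ r h)

theorem act_tmul (v : X →ₗ[F] X →ₗ[F] A) (x y : X) (m : A) :
    act v y (x ⊗ₜ m) = m * v x y := rfl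

/-- The vector space `X ⊕ A ⊕ X ⊗ A`, with the multiplication determined by a bilinear map
`v : X × X → A`: the products are `x * m = x ⊗ m`, `y * (x ⊗ m) = (x ⊗ m) * y = m * v x y`, for
`x`, `y` in `X` and `m` in `A`, and zero for the other pairs of summands. -/
def Model (_v : X →ₗ[F] X →ₗ[F] A) : Type (max v w) := X × A × (X ⊗[F] A)

namespace Model

variable (v : X →ₗ[F] X →ₗ[F] A)

instance : AddCommGroup (Model v) := inferInstanceAs (AddCommGroup (X × A × (X ⊗[F] A)))

instance : Module F (Model v) := inferInstanceAs (Module F (X × A × (X ⊗[F] A)))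

/-- The component in `X`. -/
def xPart : Model v →ₗ[F] X := LinearMap.fst F X (A × (X ⊗[F] A))

/-- The component in `A`. -/
def aPart : Model v →ₗ[F] A := LinearMap.fst F A (X ⊗[F] A) ∘ₗ LinearMap.snd F X (A × (X ⊗[F] A))

/-- The component in `X ⊗ A`. -/
def tPart : Model v →ₗ[F] X ⊗[F] A :=
  LinearMap.snd F A (X ⊗[F] A) ∘ₗ LinearMap.snd F X (A × (X ⊗[F] A))

/-- The element with given components. -/
def mk (x : X) (m : A) (h : X ⊗[F] A) : Model v := (x, m, h)

@[simp] theorem xPart_mk (x : X) (m : A) (h : X ⊗[F] A) : xPart v (mk v x m h) = x := rfl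
@[simp] theorem aPart_mk (x : X) (m : A) (h : X ⊗[F] A) : aPart v (mk v x m h) = m := rfl
@[simp] theorem tPart_mk (x : X) (m : A) (h : X ⊗[F] A) : tPart v (mk v x m h) = h := rfl

variable {v}

theorem ext_parts {p q : Model v} (hx : xPart v p = xPart v q) (ha : aPart v p = aPart v q)
    (ht : tPart v p = tPart v q) : p = q :=
  Prod.ext hx (Prod.ext ha ht)

variable (v)

/-- The multiplication as a bilinear map. -/
def mulHom : Model v →ₗ[F] Model v →ₗ[F] Model v :=
  LinearMap.mk₂ F
    (fun p q => mk v 0 (act v (xPart v q) (tPart v p) + act v (xPart v p) (tPart v q))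
      (xPart v p ⊗ₜ aPart v q))
    (fun p p' q => ext_parts (by simp) (by simp; abel) (by simp [TensorProduct.add_tmul]))
    (fun r p q => ext_parts (by simp) (by simp) (by simp [TensorProduct.smul_tmul']))
    (fun p q q' => ext_parts (by simp) (by simp; abel) (by simp [TensorProduct.tmul_add]))
    (fun r p q => ext_parts (by simp) (by simp) (by simp))

instance : Mul (Model v) := ⟨fun p q => mulHom v p q⟩

instance : NonUnitalNonAssocRing (Model v) :=
  { (inferInstance : AddCommGroup (Model v)), (inferInstance : Mul (Model v)) with
    left_distrib := fun x y z => (mulHom v x).map_add y z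
    right_distrib := fun x y z => (mulHom v).map_add₂ x y z
    zero_mul := fun x => (mulHom v).map_zero₂ x
    mul_zero := fun x => (mulHom v x).map_zero }

instance : IsScalarTower F (Model v) (Model v) :=
  ⟨fun r x y => (mulHom v).map_smul₂ r x y⟩

instance : SMulCommClass F (Model v) (Model v) :=
  ⟨fun r x y => ((mulHom v x).map_smul r y).symm⟩

variable {v}

@[simp] theorem xPart_mul (p q : Model v) : xPart v (p * q) = 0 := rfl

@[simp] theorem aPart_mul (p q : Model v) : aPart v (p * q) =
    act v (xPart v q) (tPart v p) + act v (xPart v p) (tPart v q) := rfl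

@[simp] theorem tPart_mul (p q : Model v) : tPart v (p * q) = xPart v p ⊗ₜ aPart v q := rfl

/-- Products have no $X$-component, and two elements without one multiply to zero. Alternation
enters in $(x\otimes m)x=m\,v(x,x)=0$. -/
theorem inVariety (hv : ∀ x, v x x = 0) : InVariety (Model v) where
  comm := fun a b c => by
    refine ext_parts ?_ ?_ ?_
    · simp
    · simp [add_comm]
    · simp [add_comm]
  flex := fun a b => by
    refine ext_parts ?_ ?_ ?_
    · simp
    · simp [act_tmul, hv]
    · simp
  metab := fun a b c d => by
    refine ext_parts ?_ ?_ ?_ <;> simp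

/-- The ideal of `Model v` determined by a right ideal of `A`. -/
def ideal (v : X →ₗ[F] X →ₗ[F] A) (I : Submodule F A) : Submodule F (Model v) where
  -- The tensor component is tested through its pairings with all $y$ rather than required to lie in
  -- the image of $X\otimes I$: only the pairings are elements of $A$ that can be compared with
  -- $V$-identities.
  carrier := {p | xPart v p = 0 ∧ aPart v p ∈ I ∧ ∀ y, act v y (tPart v p) ∈ I}
  add_mem' := fun {p q} hp hq => by
    refine ⟨?_, ?_, fun y => ?_⟩
    · rw [map_add, hp.1, hq.1, add_zero]
    · rw [map_add]; exact I.add_mem hp.2.1 hq.2.1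
    · rw [map_add, map_add]; exact I.add_mem (hp.2.2 y) (hq.2.2 y)
  zero_mem' := ⟨map_zero _, by rw [map_zero]; exact I.zero_mem,
    fun y => by rw [map_zero, map_zero]; exact I.zero_mem⟩
  smul_mem' := fun r p hp => by
    refine ⟨?_, ?_, fun y => ?_⟩
    · rw [map_smul, hp.1, smul_zero]
    · rw [map_smul]; exact I.smul_mem r hp.2.1
    · rw [map_smul, map_smul]; exact I.smul_mem r (hp.2.2 y)

theorem mem_ideal {I : Submodule F A} {p : Model v} :
    p ∈ ideal v I ↔ xPart v p = 0 ∧ aPart v p ∈ I ∧ ∀ y, act v y (tPart v p) ∈ I := Iff.rfl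

/-- The product acquires the tensor component $x\otimes m$ with $m\in I$, whose pairing with $y$ is
$m\,v(x,y)$; this is why stability on the right is needed. -/
theorem ideal_mul_left {I : Submodule F A} (hI : ∀ m ∈ I, ∀ x y, m * v x y ∈ I) (p q : Model v)
    (hq : q ∈ ideal v I) : p * q ∈ ideal v I := by
  obtain ⟨hx, ha, ht⟩ := hq
  refine ⟨xPart_mul p q, ?_, fun y => ?_⟩
  · rw [aPart_mul, hx, map_zero, LinearMap.zero_apply, zero_add]
    exact ht _
  · rw [tPart_mul, act_tmul]
    exact hI _ ha _ _

theorem ideal_mul_right {I : Submodule F A} (p q : Model v)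
    (hq : q ∈ ideal v I) : q * p ∈ ideal v I := by
  obtain ⟨hx, ha, ht⟩ := hq
  refine ⟨xPart_mul q p, ?_, fun y => ?_⟩
  · rw [aPart_mul, hx, map_zero, LinearMap.zero_apply, add_zero]
    exact ht _
  · rw [tPart_mul, hx, TensorProduct.zero_tmul, map_zero]
    exact I.zero_mem

/-! ### Left A-linearity of values and reduction to basic substitutions. -/

/-- The homomorphism from the free algebra with given components in `X` and in `A ⊕ X ⊗ A` of
the images of the generators. -/
def evalHom (v : X →ₗ[F] X →ₗ[F] A) (l : ℕ → X) (η : ℕ → A × (X ⊗[F] A)) :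
    Free F →ₙₐ[F] Model v :=
  FreeNonUnitalNonAssocAlgebra.lift F fun i => mk v (l i) (η i).1 (η i).2

theorem evalHom_of (l : ℕ → X) (η : ℕ → A × (X ⊗[F] A)) (i : ℕ) :
    evalHom v l η (FreeNonUnitalNonAssocAlgebra.of F i) = mk v (l i) (η i).1 (η i).2 :=
  FreeNonUnitalNonAssocAlgebra.lift_of_apply _ _ _

theorem eq_evalHom (φ : Free F →ₙₐ[F] Model v) : ∃ l η, φ = evalHom v l η := by
  refine ⟨fun i => xPart v (φ (FreeNonUnitalNonAssocAlgebra.of F i)),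
    fun i => (aPart v (φ (FreeNonUnitalNonAssocAlgebra.of F i)),
      tPart v (φ (FreeNonUnitalNonAssocAlgebra.of F i))), ?_⟩
  apply FreeNonUnitalNonAssocAlgebra.hom_ext
  intro i
  rw [evalHom_of]
  exact ext_parts rfl rfl rfl

/-- Products have no $X$-component, so only the linear part of `s` contributes to it. -/
theorem xPart_evalHom (l : ℕ → X) (η η' : ℕ → A × (X ⊗[F] A)) (s : Free F) :
    xPart v (evalHom v l η s) = xPart v (evalHom v l η' s) := by
  induction s using free_induction with
  | of i => simp [evalHom_of]
  | add x y hx hy => simp [hx, hy]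
  | zero => simp
  | mul x y hx hy => simp
  | smul r x hx => simp [hx]

/-- Values in `Model v` are linear in the components in `A ⊕ X ⊗ A` of the arguments. -/
def evalLin (v : X →ₗ[F] X →ₗ[F] A) (l : ℕ → X) (s : Free F) :
    (ℕ → A × (X ⊗[F] A)) →ₗ[F] A × (X ⊗[F] A) where
  toFun η := (aPart v (evalHom v l η s), tPart v (evalHom v l η s))
  map_add' := fun η η' => by
    induction s using free_induction with
    | of i => exact Prod.ext (by simp [evalHom_of]) (by simp [evalHom_of])
    | add x y hx hy =>
      rw [Prod.ext_iff] at hx hy ⊢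
      simp only [Prod.fst_add, Prod.snd_add, map_add] at hx hy ⊢
      rw [hx.1, hy.1, hx.2, hy.2]
      exact ⟨by abel, by abel⟩
    | zero => simp
    | mul x y hx hy =>
      rw [Prod.ext_iff] at hx hy ⊢
      simp only [Prod.fst_add, Prod.snd_add, map_mul, aPart_mul, tPart_mul] at hx hy ⊢
      rw [hx.2, hy.1, hy.2, xPart_evalHom l (η + η') η x, xPart_evalHom l (η + η') η y,
        xPart_evalHom l η' η x, xPart_evalHom l η' η y, map_add, map_add,
        TensorProduct.tmul_add]
      exact ⟨by abel, rfl⟩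
    | smul r x hx =>
      rw [Prod.ext_iff] at hx ⊢
      simp only [Prod.fst_add, Prod.snd_add, map_smul] at hx ⊢
      rw [hx.1, hx.2, smul_add, smul_add]
      exact ⟨rfl, rfl⟩
  map_smul' := fun c η => by
    induction s using free_induction with
    | of i => exact Prod.ext (by simp [evalHom_of]) (by simp [evalHom_of])
    | add x y hx hy =>
      rw [Prod.ext_iff] at hx hy ⊢
      simp only [Prod.smul_fst, Prod.smul_snd, map_add, RingHom.id_apply] at hx hy ⊢
      rw [hx.1, hy.1, hx.2, hy.2, smul_add, smul_add]
      exact ⟨rfl, rfl⟩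
    | zero => simp
    | mul x y hx hy =>
      rw [Prod.ext_iff] at hx hy ⊢
      simp only [Prod.smul_fst, Prod.smul_snd, map_mul, aPart_mul, tPart_mul,
        RingHom.id_apply] at hx hy ⊢
      rw [hx.2, hy.1, hy.2, xPart_evalHom l (c • η) η x, xPart_evalHom l (c • η) η y, map_smul,
        map_smul, smul_add, TensorProduct.tmul_smul]
      exact ⟨rfl, rfl⟩
    | smul r x hx =>
      rw [Prod.ext_iff] at hx ⊢
      simp only [Prod.smul_fst, Prod.smul_snd, map_smul, RingHom.id_apply] at hx ⊢
      rw [hx.1, hx.2, smul_comm c r, smul_comm c r]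
      exact ⟨rfl, rfl⟩

theorem evalHom_eq (l : ℕ → X) (η : ℕ → A × (X ⊗[F] A)) (s : Free F) :
    evalHom v l η s =
      mk v (xPart v (evalHom v l 0 s)) (evalLin v l s η).1 (evalLin v l s η).2 :=
  ext_parts (xPart_evalHom l η 0 s) rfl rfl

/-- Left multiplication by `m` on `A ⊕ X ⊗ A`. -/
def leftMul (X : Type v) [AddCommGroup X] [Module F X] (m : A) :
    A × (X ⊗[F] A) →ₗ[F] A × (X ⊗[F] A) :=
  (LinearMap.mulLeft F m).prodMap (LinearMap.lTensor X (LinearMap.mulLeft F m))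

theorem act_lTensor (m : A) (y : X) (h : X ⊗[F] A) :
    act v y (LinearMap.lTensor X (LinearMap.mulLeft F m) h) = m * act v y h := by
  induction h with
  | zero => simp
  | tmul x m' => simp [act_tmul, mul_assoc]
  | add h h' ih ih' => simp only [map_add, ih, ih', mul_add]

/-- The pairing multiplies by $v(x,y)$ on the right, so it commutes with left multiplications. -/
theorem evalLin_leftMul (l : ℕ → X) (m : A) (s : Free F) (η : ℕ → A × (X ⊗[F] A)) :
    evalLin v l s (fun i => leftMul X m (η i)) = leftMul X m (evalLin v l s η) := by
  induction s using free_induction with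
  | of i => simp [evalLin, leftMul, evalHom_of]
  | add x y hx hy =>
    rw [Prod.ext_iff] at hx hy ⊢
    simp only [evalLin, leftMul, LinearMap.coe_mk, AddHom.coe_mk, LinearMap.prodMap_apply,
      map_add] at hx hy ⊢
    rw [hx.1, hx.2, hy.1, hy.2]
    exact ⟨rfl, rfl⟩
  | zero => simp [evalLin, leftMul]
  | mul x y hx hy =>
    rw [Prod.ext_iff] at hx hy ⊢
    simp only [evalLin, leftMul, LinearMap.coe_mk, AddHom.coe_mk, LinearMap.prodMap_apply,
      map_mul, aPart_mul, tPart_mul] at hx hy ⊢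
    rw [hx.2, hy.1, hy.2, act_lTensor, act_lTensor, xPart_evalHom l _ η x, xPart_evalHom l _ η y]
    simp [mul_add]
  | smul r x hx =>
    rw [Prod.ext_iff] at hx ⊢
    simp only [evalLin, leftMul, LinearMap.coe_mk, AddHom.coe_mk, LinearMap.prodMap_apply,
      map_smul] at hx ⊢
    rw [hx.1, hx.2]
    exact ⟨rfl, rfl⟩

/-- Only finitely many generators occur in `s`, so `η` can be replaced by a finite sum of
`Pi.single` terms before linearity is applied. -/
theorem exists_evalHom_congr (s : Free F) : ∃ K : ℕ, ∀ (l : ℕ → X) (η η' : ℕ → A × (X ⊗[F] A)),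
    (∀ i < K, η i = η' i) → evalHom v l η s = evalHom v l η' s := by
  induction s using free_induction with
  | of i => exact ⟨i + 1, fun l η η' h => by rw [evalHom_of, evalHom_of, h i i.lt_succ_self]⟩
  | add x y hx hy =>
    obtain ⟨K, hK⟩ := hx
    obtain ⟨L, hL⟩ := hy
    exact ⟨max K L, fun l η η' h => by
      rw [map_add, map_add, hK l η η' fun i hi => h i (lt_max_of_lt_left hi),
        hL l η η' fun i hi => h i (lt_max_of_lt_right hi)]⟩
  | zero => exact ⟨0, fun l η η' _ => by rw [map_zero, map_zero]⟩
  | mul x y hx hy =>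
    obtain ⟨K, hK⟩ := hx
    obtain ⟨L, hL⟩ := hy
    exact ⟨max K L, fun l η η' h => by
      rw [map_mul, map_mul, hK l η η' fun i hi => h i (lt_max_of_lt_left hi),
        hL l η η' fun i hi => h i (lt_max_of_lt_right hi)]⟩
  | smul r x hx =>
    obtain ⟨K, hK⟩ := hx
    exact ⟨K, fun l η η' h => by rw [map_smul, map_smul, hK l η η' h]⟩

/-- The generators `1` and `x ⊗ 1` of the left `A`-module `A ⊕ X ⊗ A`. -/
def IsBasic (ζ : A × (X ⊗[F] A)) : Prop := ζ = (1, 0) ∨ ∃ x : X, ζ = (0, x ⊗ₜ 1)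

/-- To send an element of the free algebra into an ideal of `Model v` it suffices to do so for
the homomorphisms for which a single generator has a nonzero component in `A ⊕ X ⊗ A`, and
that component is `1` or `x ⊗ 1`. -/
theorem map_mem_ideal_of_basic {I : Submodule F A} (hI : ∀ a, ∀ m ∈ I, a * m ∈ I) {s : Free F}
    (hs : ∀ (l : ℕ → X) (t : ℕ) (ζ : A × (X ⊗[F] A)), IsBasic ζ →
      evalHom v l (Pi.single t ζ) s ∈ ideal v I) (φ : Free F →ₙₐ[F] Model v) :
    φ s ∈ ideal v I := by
  obtain ⟨l, η, rfl⟩ := eq_evalHom φ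
  have hx : xPart v (evalHom v l 0 s) = 0 := by
    rw [xPart_evalHom l 0 (Pi.single 0 (1, 0)) s]
    exact (hs l 0 (1, 0) (Or.inl rfl)).1
  let J : Submodule F (A × (X ⊗[F] A)) :=
    (ideal v I).comap (LinearMap.inr F X (A × (X ⊗[F] A)))
  have key : ∀ η, evalHom v l η s ∈ ideal v I ↔ evalLin v l s η ∈ J := by
    intro η
    rw [evalHom_eq, hx]
    exact Iff.rfl
  have hJ : ∀ m, ∀ ζ ∈ J, leftMul X m ζ ∈ J := by
    intro m ζ hζ
    refine ⟨rfl, hI m _ hζ.2.1, fun y => ?_⟩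
    have := hI m _ (hζ.2.2 y)
    rw [← act_lTensor] at this
    exact this
  have single_leftMul : ∀ t m (ζ : A × (X ⊗[F] A)), IsBasic ζ →
      evalLin v l s (Pi.single t (leftMul X m ζ)) ∈ J := by
    intro t m ζ hζ
    have : (Pi.single t (leftMul X m ζ) : ℕ → A × (X ⊗[F] A)) =
        fun i => leftMul X m ((Pi.single t ζ : ℕ → A × (X ⊗[F] A)) i) := by
      funext i
      rcases eq_or_ne i t with rfl | h
      · simp
      · simp [h]
    rw [this, evalLin_leftMul]
    exact hJ m _ ((key _).1 (hs l t ζ hζ))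
  -- Uses $(m,0)=m\cdot(1,0)$ and $(0,x\otimes m')=m'\cdot(0,x\otimes 1)$.
  have single_mem : ∀ t (ζ : A × (X ⊗[F] A)), evalLin v l s (Pi.single t ζ) ∈ J := by
    rintro t ⟨m, h⟩
    have hadd : ((m, h) : A × (X ⊗[F] A)) = (m, 0) + (0, h) := by simp
    rw [hadd, Pi.single_add, map_add]
    refine J.add_mem ?_ ?_
    · have := single_leftMul t m (1, 0) (Or.inl rfl)
      simpa [leftMul] using this
    · induction h with
      | zero =>
        rw [Prod.mk_zero_zero, Pi.single_zero, map_zero]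
        exact J.zero_mem
      | tmul x m' =>
        have := single_leftMul t m' (0, x ⊗ₜ 1) (Or.inr ⟨x, rfl⟩)
        simpa [leftMul] using this
      | add h h' ih ih' =>
        have hadd : ((0, h + h') : A × (X ⊗[F] A)) = (0, h) + (0, h') := by simp
        rw [hadd, Pi.single_add, map_add]
        exact J.add_mem (ih (by simp)) (ih' (by simp))
  obtain ⟨K, hK⟩ := exists_evalHom_congr (v := v) s
  rw [hK l η (∑ t ∈ Finset.range K, Pi.single t (η t)) ?_, key, map_sum]
  · exact J.sum_mem fun t _ => single_mem t _
  · intro i hi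
    simp [Finset.sum_apply, Pi.single_apply, Finset.sum_ite_eq, hi]

/-! ### Degree bounds for values in the model algebra. -/

theorem act_mem_of_mem_range {fil : ℕ → Submodule F A}
    (hmul : ∀ k, ∀ m ∈ fil k, ∀ x y, m * v x y ∈ fil (k + 1)) {N : ℕ} (y : X) {h : X ⊗[F] A}
    (hh : h ∈ LinearMap.range (LinearMap.lTensor X (fil N).subtype)) :
    act v y h ∈ fil (N + 1) := by
  obtain ⟨z, rfl⟩ := hh
  induction z with
  | zero => simp
  | tmul x m => exact hmul N m m.2 x y
  | add z z' ih ih' => rw [map_add, map_add]; exact add_mem ih ih'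

/-- The values of an element of the free algebra have bounded degree in a filtration of `A`. -/
theorem exists_degree_bound {fil : ℕ → Submodule F A} (hmono : Monotone fil)
    (hone : (1 : A) ∈ fil 0) (hmul : ∀ k, ∀ m ∈ fil k, ∀ x y, m * v x y ∈ fil (k + 1))
    (s : Free F) : ∃ N, ∀ (l : ℕ → X) (t : ℕ) (ζ : A × (X ⊗[F] A)), IsBasic ζ →
      aPart v (evalHom v l (Pi.single t ζ) s) ∈ fil N ∧
      tPart v (evalHom v l (Pi.single t ζ) s) ∈
        LinearMap.range (LinearMap.lTensor X (fil N).subtype) := by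
  have tmono : ∀ {M N : ℕ}, M ≤ N → LinearMap.range (LinearMap.lTensor X (fil M).subtype) ≤
      LinearMap.range (LinearMap.lTensor X (fil N).subtype) := by
    rintro M N h _ ⟨z, rfl⟩
    refine ⟨LinearMap.lTensor X (Submodule.inclusion (hmono h)) z, ?_⟩
    rw [← LinearMap.comp_apply, ← LinearMap.lTensor_comp, Submodule.subtype_comp_inclusion]
  have tmem : ∀ {N : ℕ} (x : X) {m : A}, m ∈ fil N →
      x ⊗ₜ m ∈ LinearMap.range (LinearMap.lTensor X (fil N).subtype) :=
    fun x m hm => ⟨x ⊗ₜ ⟨m, hm⟩, rfl⟩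
  induction s using free_induction with
  | of i =>
    refine ⟨0, fun l t ζ hζ => ?_⟩
    rw [evalHom_of, aPart_mk, tPart_mk]
    rcases eq_or_ne i t with rfl | h
    · rw [Pi.single_eq_same]
      rcases hζ with rfl | ⟨x, rfl⟩
      · exact ⟨hone, zero_mem _⟩
      · exact ⟨zero_mem _, tmem x hone⟩
    · rw [Pi.single_eq_of_ne h]
      exact ⟨zero_mem _, zero_mem _⟩
  | add x y hx hy =>
    obtain ⟨M, hM⟩ := hx
    obtain ⟨N, hN⟩ := hy
    refine ⟨max M N, fun l t ζ hζ => ?_⟩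
    rw [map_add, map_add, map_add]
    exact ⟨add_mem (hmono (le_max_left _ _) (hM l t ζ hζ).1)
        (hmono (le_max_right _ _) (hN l t ζ hζ).1),
      add_mem (tmono (le_max_left _ _) (hM l t ζ hζ).2)
        (tmono (le_max_right _ _) (hN l t ζ hζ).2)⟩
  | zero => exact ⟨0, fun l t ζ hζ => by simp⟩
  | mul x y hx hy =>
    obtain ⟨M, hM⟩ := hx
    obtain ⟨N, hN⟩ := hy
    -- A pairing contributes one more factor $v(x,y)$; forming $x\otimes m$ leaves the degree
    -- unchanged.
    refine ⟨max M N + 1, fun l t ζ hζ => ?_⟩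
    rw [map_mul, aPart_mul, tPart_mul]
    refine ⟨add_mem ?_ ?_, ?_⟩
    · exact act_mem_of_mem_range hmul _ (tmono (le_max_left _ _) (hM l t ζ hζ).2)
    · exact act_mem_of_mem_range hmul _ (tmono (le_max_right _ _) (hN l t ζ hζ).2)
    · exact tmem _ (hmono ((le_max_right _ _).trans (Nat.le_succ _)) (hN l t ζ hζ).1)
  | smul r x hx =>
    obtain ⟨M, hM⟩ := hx
    refine ⟨M, fun l t ζ hζ => ?_⟩
    rw [map_smul, map_smul, map_smul]
    exact ⟨Submodule.smul_mem _ r (hM l t ζ hζ).1, Submodule.smul_mem _ r (hM l t ζ hζ).2⟩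

end Model

end Model

/-! ### The unital operator algebra, its degree filtration and its ideals. -/

section Operators

variable (F : Type u) [Field F]

/-- The operators `V_{x, y}` as a bilinear map. -/
def Vbil : FX F →ₗ[F] FX F →ₗ[F] RightOp F :=
  LinearMap.mk₂ F (V F)
    (fun x x' y => MulOpposite.unop_injective <| LinearMap.ext fun w => by
      change ((x + x') * w) * y = (x * w) * y + (x' * w) * y
      rw [add_mul, add_mul])
    (fun r x y => MulOpposite.unop_injective <| LinearMap.ext fun w => by
      change ((r • x) * w) * y = r • ((x * w) * y)
      rw [smul_mul_assoc, smul_mul_assoc])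
    (fun x y y' => MulOpposite.unop_injective <| LinearMap.ext fun w => by
      change (x * w) * (y + y') = (x * w) * y + (x * w) * y'
      rw [mul_add])
    (fun r x y => MulOpposite.unop_injective <| LinearMap.ext fun w => by
      change (x * w) * (r • y) = r • ((x * w) * y)
      rw [mul_smul_comm])

variable {F}

theorem V_swap (x y : FX F) : V F x y = -V F y x := by
  have h : Vbil F (x + y) (x + y) = 0 := V_self (x + y)
  have hx : Vbil F x x = 0 := V_self x
  have hy : Vbil F y y = 0 := V_self y
  rw [map_add, map_add, LinearMap.add_apply, LinearMap.add_apply, hx, hy, zero_add, add_zero] at h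
  exact eq_neg_of_add_eq_zero_right h

/-- The linear forms in the generators of `F(X)`. -/
def linForm : (ℕ →₀ F) →ₗ[F] FX F := Finsupp.linearCombination F (RelFree.gen (definingIdentities F))

theorem linForm_single (i : ℕ) :
    linForm (Finsupp.single i (1 : F)) = RelFree.gen (definingIdentities F) i := by
  rw [linForm, Finsupp.linearCombination_single, one_smul]

/-- Expand bilinearly; alternation removes the terms $i=j$ and reverses those with $i>j$. -/
theorem V_linForm_mem_span (x y : ℕ →₀ F) :
    V F (linForm x) (linForm y) ∈ Submodule.span F (Vgen F '' {p | p.1 < p.2}) := by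
  change Vbil F (linForm x) (linForm y) ∈ _
  induction x using Finsupp.induction_linear with
  | zero => simp
  | add x x' hx hx' => rw [map_add, map_add, LinearMap.add_apply]; exact add_mem hx hx'
  | single i r =>
    induction y using Finsupp.induction_linear with
    | zero => simp
    | add y y' hy hy' => rw [map_add, map_add]; exact add_mem hy hy'
    | single j r' =>
      have hV : V F (RelFree.gen _ i) (RelFree.gen _ j) ∈
          Submodule.span F (Vgen F '' {p | p.1 < p.2}) := by
        rcases lt_trichotomy i j with h | rfl | h
        · exact Submodule.subset_span ⟨(i, j), h, rfl⟩
        · rw [V_self]; exact zero_mem _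
        · rw [V_swap]
          exact neg_mem (Submodule.subset_span ⟨(j, i), h, rfl⟩)
      rw [linForm, Finsupp.linearCombination_single, Finsupp.linearCombination_single,
        map_smul, map_smul, LinearMap.smul_apply]
      exact Submodule.smul_mem _ _ (Submodule.smul_mem _ _ hV)

theorem span_Vgen_le_E0 :
    Submodule.span F (Vgen F '' {p | p.1 < p.2}) ≤ (E0 F).toSubmodule :=
  Submodule.span_le.2 fun _ h => NonUnitalAlgebra.subset_adjoin F h

theorem V_linForm_mem_E0 (x y : ℕ →₀ F) : V F (linForm x) (linForm y) ∈ E0 F :=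
  span_Vgen_le_E0 (V_linForm_mem_span x y)

variable (F) in
/-- The algebra of operators with identity generated by all `V_{x i, x j}` with `i < j`. -/
def E1Subalgebra : Subalgebra F (RightOp F) := Algebra.adjoin F (Vgen F '' {p | p.1 < p.2})

theorem mem_E1_of_mem_E0 {f : RightOp F} (hf : f ∈ E0 F) : f ∈ E1Subalgebra F := by
  induction hf using NonUnitalAlgebra.adjoin_induction with
  | mem x hx => exact Algebra.subset_adjoin hx
  | add x y _ _ hx hy => exact add_mem hx hy
  | zero => exact zero_mem _
  | mul x y _ _ hx hy => exact mul_mem hx hy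
  | smul r x _ hx => exact Subalgebra.smul_mem _ hx r

variable (F) in
/-- The algebra `E1Subalgebra` as a type. -/
def E1 : Type u := E1Subalgebra F

instance : Ring (E1 F) := inferInstanceAs (Ring (E1Subalgebra F))

instance : Algebra F (E1 F) := inferInstanceAs (Algebra F (E1Subalgebra F))

namespace E1

variable (F) in
/-- The inclusion of `E1` into the algebra of all operators. -/
def val : E1 F →ₐ[F] RightOp F := (E1Subalgebra F).val

/-- An operator of the subalgebra as an element of `E1`. -/
def mk (f : RightOp F) (hf : f ∈ E1Subalgebra F) : E1 F := ⟨f, hf⟩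

theorem val_mem (m : E1 F) : val F m ∈ E1Subalgebra F := m.2

theorem val_injective : Function.Injective (val F) := Subtype.val_injective

end E1

variable (F) in
/-- The operators `V_{x, y}`, for linear forms `x` and `y`, as a bilinear map to `E1`. -/
def vForm : (ℕ →₀ F) →ₗ[F] (ℕ →₀ F) →ₗ[F] E1 F :=
  LinearMap.mk₂ F
    (fun x y => E1.mk (V F (linForm x) (linForm y)) (mem_E1_of_mem_E0 (V_linForm_mem_E0 x y)))
    (fun x x' y => E1.val_injective <| by
      rw [map_add (E1.val F)]
      change Vbil F (linForm (x + x')) (linForm y) =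
        Vbil F (linForm x) (linForm y) + Vbil F (linForm x') (linForm y)
      rw [map_add, LinearMap.map_add₂])
    (fun r x y => E1.val_injective <| by
      rw [map_smul (E1.val F)]
      change Vbil F (linForm (r • x)) (linForm y) = r • Vbil F (linForm x) (linForm y)
      rw [map_smul, LinearMap.map_smul₂])
    (fun x y y' => E1.val_injective <| by
      rw [map_add (E1.val F)]
      change Vbil F (linForm x) (linForm (y + y')) =
        Vbil F (linForm x) (linForm y) + Vbil F (linForm x) (linForm y')
      rw [map_add, map_add])
    (fun r x y => E1.val_injective <| by
      rw [map_smul (E1.val F)]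
      change Vbil F (linForm x) (linForm (r • y)) = r • Vbil F (linForm x) (linForm y)
      rw [map_smul, map_smul])

theorem val_vForm (x y : ℕ →₀ F) : E1.val F (vForm F x y) = V F (linForm x) (linForm y) := rfl

theorem vForm_self (x : ℕ →₀ F) : vForm F x x = 0 :=
  E1.val_injective (by rw [val_vForm, V_self, map_zero])

variable (F) in
/-- The operators of degree at most `2 k`, constants included. -/
def words (k : ℕ) : Submodule F (RightOp F) :=
  Submodule.span F {w | ∃ l : List (ℕ × ℕ),
    (∀ p ∈ l, p.1 < p.2) ∧ l.length ≤ k ∧ w = (l.map (Vgen F)).prod}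

theorem words_mono : Monotone (words F) := by
  intro k k' h
  refine Submodule.span_mono ?_
  rintro _ ⟨l, hl, hk, rfl⟩
  exact ⟨l, hl, hk.trans h, rfl⟩

theorem one_mem_words : (1 : RightOp F) ∈ words F 0 :=
  Submodule.subset_span ⟨[], by simp, le_rfl, by simp⟩

theorem words_mul {k : ℕ} {m : RightOp F} (hm : m ∈ words F k) (x y : ℕ →₀ F) :
    m * V F (linForm x) (linForm y) ∈ words F (k + 1) := by
  have hV := V_linForm_mem_span x y
  generalize V F (linForm x) (linForm y) = e at hV
  induction hm using Submodule.span_induction with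
  | mem w hw =>
    obtain ⟨l, hl, hk, rfl⟩ := hw
    induction hV using Submodule.span_induction with
    | mem e he =>
      obtain ⟨p, hp, rfl⟩ := he
      refine Submodule.subset_span ⟨l ++ [p], ?_, ?_, ?_⟩
      · intro q hq
        rcases List.mem_append.1 hq with hq | hq
        · exact hl q hq
        · rw [List.mem_singleton.1 hq]; exact hp
      · rw [List.length_append, List.length_singleton]; exact Nat.succ_le_succ hk
      · simp
    | zero => rw [mul_zero]; exact zero_mem _
    | add e e' _ _ he he' => rw [mul_add]; exact add_mem he he'
    | smul r e _ he => rw [mul_smul_comm]; exact Submodule.smul_mem _ r he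
  | zero => rw [zero_mul]; exact zero_mem _
  | add m m' _ _ hm hm' => rw [add_mul]; exact add_mem hm hm'
  | smul r m _ hm => rw [smul_mul_assoc]; exact Submodule.smul_mem _ r hm

variable (F) in
/-- The operators of degree at most `2 k`, constants included, as a subspace of `E1`. -/
def wordsE1 (k : ℕ) : Submodule F (E1 F) := (words F k).comap (E1.val F).toLinearMap

theorem mem_wordsE1 {k : ℕ} {m : E1 F} : m ∈ wordsE1 F k ↔ E1.val F m ∈ words F k := Iff.rfl

theorem wordsE1_mono : Monotone (wordsE1 F) := fun _ _ h _ hm => words_mono h hm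

theorem one_mem_wordsE1 : (1 : E1 F) ∈ wordsE1 F 0 :=
  mem_wordsE1.2 <| by rw [map_one]; exact one_mem_words

theorem wordsE1_mul (k : ℕ) (m : E1 F) (hm : m ∈ wordsE1 F k) (x y : ℕ →₀ F) :
    m * vForm F x y ∈ wordsE1 F (k + 1) :=
  mem_wordsE1.2 <| by
    rw [map_mul, val_vForm]
    exact words_mul (mem_wordsE1.1 hm) x y

theorem list_prod_mem_E0 {l : List (ℕ × ℕ)} (h0 : l ≠ []) (hl : ∀ p ∈ l, p.1 < p.2) :
    (l.map (Vgen F)).prod ∈ E0 F := by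
  induction l with
  | nil => exact absurd rfl h0
  | cons p l ih =>
    have hp : Vgen F p ∈ E0 F :=
      NonUnitalAlgebra.subset_adjoin F ⟨p, hl p List.mem_cons_self, rfl⟩
    rcases eq_or_ne l [] with rfl | h
    · simpa using hp
    · rw [List.map_cons, List.prod_cons]
      exact mul_mem hp (ih h fun q hq => hl q (List.mem_cons_of_mem p hq))

/-- Splits off the contribution of the empty word, which `DegreeLE` excludes. -/
theorem exists_of_mem_words {k : ℕ} {m : RightOp F} (hm : m ∈ words F k) :
    ∃ (r : F) (e : E0 F), DegreeLE (2 * k) e ∧ m = r • 1 + (e : RightOp F) := by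
  induction hm using Submodule.span_induction with
  | mem w hw =>
    obtain ⟨l, hl, hk, rfl⟩ := hw
    rcases eq_or_ne l [] with rfl | h
    · exact ⟨1, 0, zero_mem _, by simp⟩
    · exact ⟨0, ⟨_, list_prod_mem_E0 h hl⟩,
        Submodule.subset_span ⟨l, h, hl, Nat.mul_le_mul_left 2 hk, rfl⟩, by simp⟩
  | zero => exact ⟨0, 0, zero_mem _, by simp⟩
  | add m m' _ _ hm hm' =>
    obtain ⟨r, e, he, rfl⟩ := hm
    obtain ⟨r', e', he', rfl⟩ := hm'
    refine ⟨r + r', e + e', add_mem he he', ?_⟩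
    rw [add_smul, NonUnitalSubalgebra.coe_add]
    abel
  | smul c m _ hm =>
    obtain ⟨r, e, he, rfl⟩ := hm
    refine ⟨c * r, c • e, Submodule.smul_mem _ c he, ?_⟩
    rw [smul_add, mul_smul, NonUnitalSubalgebra.coe_smul]

variable {B : Type v} [NonUnitalNonAssocRing B] [Module F B]

theorem map_Vgen_apply (ψ : FX F →ₙₐ[F] B) (p : ℕ × ℕ) (z : FX F) :
    ψ ((Vgen F p).unop z) = (ψ (RelFree.gen _ p.1) * ψ z) * ψ (RelFree.gen _ p.2) := by
  rw [Vgen, V_apply, map_mul, map_mul]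

/-- Operators of $E_0$ preserve the kernel of `ψ`, so they act on its image. Hence the
$V$-identities are closed under right multiplication. -/
theorem map_apply_eq_zero (ψ : FX F →ₙₐ[F] B) {f : RightOp F} (hf : f ∈ E0 F) :
    ∀ z, ψ z = 0 → ψ (f.unop z) = 0 := by
  induction hf using NonUnitalAlgebra.adjoin_induction with
  | mem x hx =>
    obtain ⟨p, _, rfl⟩ := hx
    intro z hz
    rw [map_Vgen_apply, hz, mul_zero, zero_mul]
  | add x y _ _ hx hy =>
    intro z hz
    rw [MulOpposite.unop_add, LinearMap.add_apply, map_add, hx z hz, hy z hz, add_zero]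
  | zero => intro z _; exact map_zero ψ
  | mul x y _ _ hx hy => exact fun z hz => hy _ (hx z hz)
  | smul r x _ hx =>
    intro z hz
    rw [MulOpposite.unop_smul, LinearMap.smul_apply, map_smul, hx z hz, smul_zero]

theorem mul_mem_vIdentities (u f : E0 F) (hf : f ∈ vIdentities F B) :
    u * f ∈ vIdentities F B ∧ f * u ∈ vIdentities F B :=
  ⟨fun φ w => hf φ ((u : RightOp F).unop w), fun φ w => map_apply_eq_zero φ u.2 _ (hf φ w)⟩

theorem subset_idealSpan (G : Set (E0 F)) : G ⊆ idealSpan G :=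
  fun _ hg => Submodule.mem_sInf.2 fun _ hI => hI.1 hg

theorem mul_mem_idealSpan {G : Set (E0 F)} (u f : E0 F) (hf : f ∈ idealSpan G) :
    u * f ∈ idealSpan G ∧ f * u ∈ idealSpan G :=
  ⟨Submodule.mem_sInf.2 fun I hI => (hI.2 u f (Submodule.mem_sInf.1 hf I hI)).1,
    Submodule.mem_sInf.2 fun I hI => (hI.2 u f (Submodule.mem_sInf.1 hf I hI)).2⟩

/-- The ideal of `E0` generated by `G`, as a subspace of `E1`. -/
def idealE1 (G : Set (E0 F)) : Submodule F (E1 F) :=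
  ((idealSpan G).map (E0 F).toSubmodule.subtype).comap (E1.val F).toLinearMap

theorem mem_idealE1 {G : Set (E0 F)} {m : E1 F} :
    m ∈ idealE1 G ↔ ∃ g ∈ idealSpan G, (g : RightOp F) = E1.val F m := Iff.rfl

/-- Adjoining the identity adds only scalars, and ideals of $E_0$ are $F$-subspaces. -/
theorem mul_mem_idealE1 {G : Set (E0 F)} (a m : E1 F) (hm : m ∈ idealE1 G) :
    a * m ∈ idealE1 G := by
  obtain ⟨g, hg, hgm⟩ := mem_idealE1.1 hm
  have ha := E1.val_mem a
  suffices h : ∀ g ∈ idealSpan G, ∃ g' ∈ idealSpan G, (g' : RightOp F) = E1.val F a * g by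
    obtain ⟨g', hg', h⟩ := h g hg
    exact mem_idealE1.2 ⟨g', hg', by rw [h, hgm, map_mul]⟩
  generalize E1.val F a = a at ha
  clear hm hgm hg g m
  induction ha using Algebra.adjoin_induction with
  | mem x hx =>
    exact fun g hg => ⟨⟨x, NonUnitalAlgebra.subset_adjoin F hx⟩ * g,
      (mul_mem_idealSpan _ g hg).1, rfl⟩
  | algebraMap r =>
    exact fun g hg => ⟨r • g, Submodule.smul_mem _ r hg, Algebra.smul_def r (g : RightOp F)⟩
  | add x y _ _ hx hy =>
    intro g hg
    obtain ⟨g₁, h₁, e₁⟩ := hx g hg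
    obtain ⟨g₂, h₂, e₂⟩ := hy g hg
    exact ⟨g₁ + g₂, add_mem h₁ h₂, by rw [add_mul, ← e₁, ← e₂]; rfl⟩
  | mul x y _ _ hx hy =>
    intro g hg
    obtain ⟨g₂, h₂, e₂⟩ := hy g hg
    obtain ⟨g₁, h₁, e₁⟩ := hx g₂ h₂
    exact ⟨g₁, h₁, by rw [e₁, e₂, mul_assoc]⟩

theorem mul_vForm_mem_idealE1 {G : Set (E0 F)} (m : E1 F) (hm : m ∈ idealE1 G)
    (x y : ℕ →₀ F) : m * vForm F x y ∈ idealE1 G := by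
  obtain ⟨g, hg, hgm⟩ := mem_idealE1.1 hm
  refine mem_idealE1.2 ⟨g * ⟨_, V_linForm_mem_E0 x y⟩, (mul_mem_idealSpan _ g hg).2, ?_⟩
  change (g : RightOp F) * V F (linForm x) (linForm y) = _
  rw [hgm, map_mul, val_vForm]

end Operators

/-! ### Homomorphisms from the model algebra to P_n. -/

section Evaluation

variable {F : Type u} [Field F] {n : ℕ}

open P

theorem cPart_map_apply (ψ : FX F →ₙₐ[F] P F n) {f : RightOp F} (hf : f ∈ E0 F) :
    ∀ z, cPart (ψ (f.unop z)) = ψ (f.unop z) := by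
  induction hf using NonUnitalAlgebra.adjoin_induction with
  | mem x hx =>
    obtain ⟨p, _, rfl⟩ := hx
    intro z
    rw [map_Vgen_apply, cPart_mul_mul]
  | add x y _ _ hx hy =>
    intro z
    rw [MulOpposite.unop_add, LinearMap.add_apply, map_add, map_add, hx z, hy z]
  | zero => intro z; exact (congrArg cPart (map_zero ψ)).trans ((map_zero _).trans (map_zero ψ).symm)
  | mul x y _ _ hx hy => exact fun z => hy _
  | smul r x _ hx =>
    intro z
    rw [MulOpposite.unop_smul, LinearMap.smul_apply, map_smul, map_smul, hx z]

theorem map_apply_eq_zero_of_cPart (ψ : FX F →ₙₐ[F] P F n)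
    (hψ : ∀ i, cPart (ψ (RelFree.gen _ i)) = ψ (RelFree.gen _ i)) {f : RightOp F}
    (hf : f ∈ E0 F) : ∀ z, ψ (f.unop z) = 0 := by
  induction hf using NonUnitalAlgebra.adjoin_induction with
  | mem x hx =>
    obtain ⟨p, _, rfl⟩ := hx
    intro z
    rw [map_Vgen_apply, ← hψ p.1, cPart_mul, zero_mul]
  | add x y _ _ hx hy =>
    intro z
    rw [MulOpposite.unop_add, LinearMap.add_apply, map_add, hx z, hy z, add_zero]
  | zero => intro z; exact map_zero ψ
  | mul x y _ _ hx hy => exact fun z => hy _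
  | smul r x _ hx =>
    intro z
    rw [MulOpposite.unop_smul, LinearMap.smul_apply, map_smul, hx z, smul_zero]

/-- The operators of bounded degree that vanish on `P_n`, possibly up to a constant term, are
`V`-identities. -/
theorem exists_vIdentity (hn : 0 < n) {k : ℕ} {m : RightOp F} (hm : m ∈ words F k)
    (h : ∀ (ψ : FX F →ₙₐ[F] P F n) (w : FX F), cPart (ψ (m.unop w)) = 0) :
    ∃ g : E0 F, g ∈ vIdentities F (P F n) ∧ DegreeLE (2 * k) g ∧ (g : RightOp F) = m := by
  obtain ⟨r, e, he, rfl⟩ := exists_of_mem_words hm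
  -- Send every generator to one $c_{i_0}$: left multiplication by it is zero, so the $E_0$-part
  -- vanishes and $r\,c_{i_0}=0$ remains.
  have hr : r = 0 := by
    let i₀ : Fin n := ⟨0, hn⟩
    let ψ : FX F →ₙₐ[F] P F n := descend P.inVariety
      (FreeNonUnitalNonAssocAlgebra.lift F fun _ => basis (.c i₀))
    have hgen : ∀ i, ψ (RelFree.gen _ i) = basis (.c i₀) := fun i => by
      rw [descend_gen, FreeNonUnitalNonAssocAlgebra.lift_of_apply]
    have hc : cPart (basis (.c i₀) : P F n) = basis (.c i₀) := by
      refine ext_coord fun k => ?_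
      rcases k with ⟨i, j⟩ | ⟨i, j⟩ | j | ⟨i, j⟩ | ⟨i, j⟩ <;> simp [coord_basis_of_ne]
    have h0 := h ψ (RelFree.gen _ 0)
    rw [MulOpposite.unop_add, LinearMap.add_apply, map_add,
      map_apply_eq_zero_of_cPart ψ (fun i => by rw [hgen, hc]) e.2, add_zero,
      MulOpposite.unop_smul, LinearMap.smul_apply, MulOpposite.unop_one, Module.End.one_apply,
      map_smul, map_smul, hgen, hc] at h0
    have := congrArg (coord (.c i₀)) h0
    rwa [map_smul, coord_basis_self, map_zero, smul_eq_mul, mul_one] at this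
  subst hr
  simp only [zero_smul, zero_add] at h ⊢
  exact ⟨e, fun ψ w => by rw [← cPart_map_apply ψ e.2, h ψ w], he, rfl⟩

/-- The value on `ψ w` of an operator, projected to the span of the `c i`. -/
def evalC (ψ : FX F →ₙₐ[F] P F n) (w : FX F) : E1 F →ₗ[F] P F n where
  toFun m := cPart (ψ ((E1.val F m).unop w))
  map_add' m m' := by
    rw [map_add (E1.val F), MulOpposite.unop_add, LinearMap.add_apply, map_add, map_add]
  map_smul' r m := by
    rw [map_smul (E1.val F), MulOpposite.unop_smul, LinearMap.smul_apply, map_smul, map_smul,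
      RingHom.id_apply]

theorem evalC_apply (ψ : FX F →ₙₐ[F] P F n) (w : FX F) (m : E1 F) :
    evalC ψ w m = cPart (ψ ((E1.val F m).unop w)) := rfl

/-- The projection of the value of a linear form to the span of the `a i j` and `b i j`. -/
def evalAB (ψ : FX F →ₙₐ[F] P F n) : (ℕ →₀ F) →ₗ[F] P F n :=
  abPart ∘ₗ (ψ : FX F →ₗ[F] P F n) ∘ₗ linForm

theorem evalAB_apply (ψ : FX F →ₙₐ[F] P F n) (x : ℕ →₀ F) :
    evalAB ψ x = abPart (ψ (linForm x)) := rfl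

/-- The linear map `x ⊗ m ↦ evalAB x * evalC m`. -/
def evalT (ψ : FX F →ₙₐ[F] P F n) (w : FX F) : (ℕ →₀ F) ⊗[F] E1 F →ₗ[F] P F n :=
  TensorProduct.lift ((LinearMap.mul F (P F n)).compl₁₂ (evalAB ψ) (evalC ψ w))

theorem evalT_tmul (ψ : FX F →ₙₐ[F] P F n) (w : FX F) (x : ℕ →₀ F) (m : E1 F) :
    evalT ψ w (x ⊗ₜ m) = evalAB ψ x * evalC ψ w m := rfl

theorem evalC_mul_vForm (ψ : FX F →ₙₐ[F] P F n) (w : FX F) (x y : ℕ →₀ F) (m : E1 F) :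
    evalC ψ w (m * vForm F x y) = (evalAB ψ x * evalC ψ w m) * evalAB ψ y := by
  rw [evalC_apply, map_mul, val_vForm, MulOpposite.unop_mul, Module.End.mul_apply, V_apply,
    map_mul ψ, map_mul ψ, cPart_mul_mul, mul_mul_eq, evalC_apply, evalAB_apply, evalAB_apply]

/-- Turns vanishing of a tensor component on $P_n$ into vanishing of the operators obtained by
pairing it with each $y$. -/
theorem evalC_act (ψ : FX F →ₙₐ[F] P F n) (w : FX F) (y : ℕ →₀ F)
    (h : (ℕ →₀ F) ⊗[F] E1 F) :
    evalC ψ w (act (vForm F) y h) = evalT ψ w h * evalAB ψ y := by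
  induction h with
  | zero => simp
  | tmul x m => rw [act_tmul, evalC_mul_vForm, evalT_tmul]
  | add h h' ih ih' => simp only [map_add, ih, ih', add_mul]

theorem evalAB_mul_evalT (ψ : FX F →ₙₐ[F] P F n) (w : FX F) (y : ℕ →₀ F)
    (h : (ℕ →₀ F) ⊗[F] E1 F) : evalAB ψ y * evalT ψ w h = evalT ψ w h * evalAB ψ y := by
  induction h with
  | zero => simp
  | tmul x m => exact abPart_mul_mul _ _ _
  | add h h' ih ih' => simp only [map_add, ih, ih', add_mul, mul_add]

theorem evalT_mul_evalC (ψ : FX F →ₙₐ[F] P F n) (w : FX F) (h : (ℕ →₀ F) ⊗[F] E1 F)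
    (m : E1 F) : evalT ψ w h * evalC ψ w m = 0 := by
  induction h with
  | zero => simp
  | tmul x m' => exact mul_mul_cPart _ _ _
  | add h h' ih ih' => simp only [map_add, ih, ih', add_mul, add_zero]

theorem evalT_mul_evalT (ψ : FX F →ₙₐ[F] P F n) (w : FX F) (h h' : (ℕ →₀ F) ⊗[F] E1 F) :
    evalT ψ w h * evalT ψ w h' = 0 := by
  induction h with
  | zero => simp
  | tmul x m =>
    induction h' with
    | zero => simp
    | tmul x' m' => exact P.inVariety.metab _ _ _ _
    | add h h' ih ih' => simp only [map_add, ih, ih', mul_add, add_zero]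
  | add h h' ih ih' => simp only [map_add, ih, ih', add_mul, add_zero]

theorem abPart_evalT (ψ : FX F →ₙₐ[F] P F n) (w : FX F) (h : (ℕ →₀ F) ⊗[F] E1 F) :
    abPart (evalT ψ w h) = 0 := by
  induction h with
  | zero => simp
  | tmul x m => exact abPart_abPart_mul_cPart _ _
  | add h h' ih ih' => simp only [map_add, ih, ih', add_zero]

theorem cPart_evalT (ψ : FX F →ₙₐ[F] P F n) (w : FX F) (h : (ℕ →₀ F) ⊗[F] E1 F) :
    cPart (evalT ψ w h) = 0 := by
  induction h with
  | zero => simp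
  | tmul x m => exact cPart_abPart_mul_cPart _ _
  | add h h' ih ih' => simp only [map_add, ih, ih', add_zero]

open Model in
/-- The homomorphism from the model algebra of `E1` to `P_n` given by a homomorphism
`ψ : F(X) → P_n` and an element `w` of `F(X)`. -/
def evalModel (ψ : FX F →ₙₐ[F] P F n) (w : FX F) : Model (vForm F) →ₙₐ[F] P F n where
  toFun p := evalAB ψ (xPart _ p) + evalC ψ w (aPart _ p) + evalT ψ w (tPart _ p)
  map_smul' r p := by simp only [map_smul, smul_add, MonoidHom.id_apply]
  map_zero' := by simp only [map_zero, add_zero]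
  map_add' p q := by simp only [map_add]; abel
  map_mul' p q := by
    have h1 : evalAB ψ (xPart _ p) * evalAB ψ (xPart _ q) = 0 := abPart_mul_abPart _ _
    have h2 : ∀ z, evalC ψ w (aPart _ p) * z = 0 := fun z => cPart_mul _ z
    simp only [xPart_mul, aPart_mul, tPart_mul, map_add, map_zero, evalC_act, evalT_tmul,
      mul_add, add_mul, h1, h2, evalT_mul_evalC, evalT_mul_evalT, evalAB_mul_evalT]
    abel

theorem evalModel_apply (ψ : FX F →ₙₐ[F] P F n) (w : FX F) (p : Model (vForm F)) :
    evalModel ψ w p = evalAB ψ (Model.xPart _ p) + evalC ψ w (Model.aPart _ p) +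
      evalT ψ w (Model.tPart _ p) := rfl

/-- The three summands map to the spans of the $a,b$, of the $c$ and of the $d,e$, which are
independent in $P_n$. -/
theorem evalModel_eq_zero {ψ : FX F →ₙₐ[F] P F n} {w : FX F} {p : Model (vForm F)}
    (h : evalModel ψ w p = 0) : evalAB ψ (Model.xPart _ p) = 0 ∧
      evalC ψ w (Model.aPart _ p) = 0 ∧ evalT ψ w (Model.tPart _ p) = 0 := by
  rw [evalModel_apply] at h
  have hab := congrArg abPart h
  rw [map_add, map_add, abPart_evalT, evalC_apply, abPart_cPart, evalAB_apply, abPart_abPart,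
    map_zero, add_zero, add_zero, ← evalAB_apply] at hab
  have hc := congrArg cPart h
  rw [map_add, map_add, cPart_evalT, evalC_apply, cPart_cPart, evalAB_apply, cPart_abPart,
    map_zero, add_zero, zero_add, ← evalC_apply] at hc
  rw [hab, hc, zero_add, zero_add] at h
  exact ⟨hab, hc, h⟩

/-- Sending $x_k$ to a basis element $a_{i_0i_0}$ and the other generators to $0$ reads off the
$k$-th coefficient. -/
theorem eq_zero_of_evalAB_eq_zero (hn : 0 < n) {x : ℕ →₀ F}
    (h : ∀ ψ : FX F →ₙₐ[F] P F n, evalAB ψ x = 0) : x = 0 := by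
  ext k
  let i₀ : Fin n := ⟨0, hn⟩
  let ψ : FX F →ₙₐ[F] P F n := descend P.inVariety
    (FreeNonUnitalNonAssocAlgebra.lift F fun i => if i = k then basis (.a i₀ i₀) else 0)
  have hx : coord (.a i₀ i₀) (ψ (linForm x)) = x k := by
    have : coord (.a i₀ i₀) ∘ₗ (ψ : FX F →ₗ[F] P F n) ∘ₗ linForm = Finsupp.lapply k := by
      refine Finsupp.lhom_ext' fun i => LinearMap.ext_ring ?_
      change coord (.a i₀ i₀) (ψ (linForm (Finsupp.single i 1))) = Finsupp.single i 1 k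
      rw [linForm_single, descend_gen, FreeNonUnitalNonAssocAlgebra.lift_of_apply,
        Finsupp.single_apply]
      split_ifs
      · exact coord_basis_self _
      · exact map_zero _
    exact LinearMap.congr_fun this x
  have := congrArg (coord (.a i₀ i₀)) (h ψ)
  rw [evalAB_apply, coord_abPart_a, hx] at this
  simpa using this

end Evaluation

/-! ### From a finite basis to a degree bound. -/

section Main

variable {F : Type u} [Field F] {n : ℕ}

open Model

variable (F n) in
/-- The `V`-identities of `P_n` of degree at most `d`. -/
def boundedVIdentities (d : ℕ) : Set (E0 F) := {g | g ∈ vIdentities F (P F n) ∧ DegreeLE d g}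

theorem idealSpan_boundedVIdentities_le (d : ℕ) :
    idealSpan (boundedVIdentities F n d) ≤ vIdentities F (P F n) :=
  sInf_le ⟨fun _ hg => hg.1, fun u f hf => mul_mem_vIdentities u f hf⟩

theorem degreeLE_mono {d d' : ℕ} (h : d ≤ d') {f : E0 F} (hf : DegreeLE d f) : DegreeLE d' f := by
  refine Submodule.span_mono ?_ hf
  rintro _ ⟨l, h0, hl, hd, rfl⟩
  exact ⟨l, h0, hl, hd.trans h, rfl⟩

theorem mem_idealE1_of_evalC (hn : 0 < n) {k d : ℕ} (hk : 2 * k ≤ d) {m : E1 F}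
    (hm : m ∈ wordsE1 F k)
    (h : ∀ (ψ : FX F →ₙₐ[F] P F n) (w : FX F), evalC ψ w m = 0) :
    m ∈ idealE1 (boundedVIdentities F n d) := by
  obtain ⟨g, hg, hd, e⟩ := exists_vIdentity hn hm h
  exact mem_idealE1.2 ⟨g, subset_idealSpan _ ⟨hg, degreeLE_mono hk hd⟩, e⟩

/-- Every homomorphism to the model algebra sends an identity of `P_n` to the ideal determined
by the `V`-identities of sufficiently large bounded degree. -/
theorem exists_bound_map_mem_ideal (hn : 0 < n) {s : Free F} (hs : s ∈ identities F (P F n)) :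
    ∃ N, ∀ d, N ≤ d → ∀ φ : Free F →ₙₐ[F] Model (vForm F),
      φ s ∈ ideal (vForm F) (idealE1 (boundedVIdentities F n d)) := by
  obtain ⟨N, hN⟩ := exists_degree_bound (v := vForm F) (fil := wordsE1 F) wordsE1_mono
    one_mem_wordsE1 wordsE1_mul s
  -- The $A$-component is a combination of words with at most $N$ factors; pairing the tensor
  -- component with $y$ adds one factor, and each factor has degree $2$.
  refine ⟨2 * (N + 1), fun d hd φ => map_mem_ideal_of_basic (v := vForm F)
    (I := idealE1 (boundedVIdentities F n d)) mul_mem_idealE1 ?_ φ⟩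
  intro l t ζ hζ
  obtain ⟨ha, ht⟩ := hN l t ζ hζ
  -- The composite of the substitution with `evalModel` is a homomorphism to $P_n$, so it kills `s`.
  have h0 := fun (ψ : FX F →ₙₐ[F] P F n) (w : FX F) =>
    evalModel_eq_zero (p := evalHom (vForm F) l (Pi.single t ζ) s)
      (hs ((evalModel ψ w).comp (evalHom (vForm F) l (Pi.single t ζ))))
  refine mem_ideal.2 ⟨eq_zero_of_evalAB_eq_zero hn fun ψ => (h0 ψ 0).1, ?_, fun y => ?_⟩
  · exact mem_idealE1_of_evalC hn (by omega) ha fun ψ w => (h0 ψ w).2.1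
  · refine mem_idealE1_of_evalC hn hd 
      (act_mem_of_mem_range (v := vForm F) (fil := wordsE1 F) wordsE1_mul y ht) fun ψ w => ?_
    rw [evalC_act, (h0 ψ w).2.2, zero_mul]

/-- The action of `E0` on the model algebra. -/
theorem parts_map_apply (ψ : FX F →ₙₐ[F] Model (vForm F))
    (hψ : ∀ i, xPart (vForm F) (ψ (RelFree.gen _ i)) = Finsupp.single i 1) {f : RightOp F}
    (hf : f ∈ E0 F) : ∀ z, tPart (vForm F) (ψ z) = 0 → tPart (vForm F) (ψ (f.unop z)) = 0 ∧
      E1.val F (aPart (vForm F) (ψ (f.unop z))) = E1.val F (aPart (vForm F) (ψ z)) * f := by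
  induction hf using NonUnitalAlgebra.adjoin_induction with
  | mem x hx =>
    obtain ⟨p, _, rfl⟩ := hx
    intro z hz
    rw [map_Vgen_apply, tPart_mul, xPart_mul, TensorProduct.zero_tmul, aPart_mul, xPart_mul,
      map_zero, LinearMap.zero_apply, add_zero, tPart_mul, act_tmul, hψ, hψ]
    refine ⟨rfl, ?_⟩
    rw [map_mul, val_vForm, linForm_single, linForm_single, Vgen]
  | add x y _ _ hx hy =>
    intro z hz
    obtain ⟨h1, h2⟩ := hx z hz
    obtain ⟨h3, h4⟩ := hy z hz
    rw [MulOpposite.unop_add, LinearMap.add_apply, map_add, map_add, map_add, h1, h3, mul_add,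
      ← h2, ← h4]
    exact ⟨add_zero _, map_add _ _ _⟩
  | zero =>
    intro z _
    rw [mul_zero, MulOpposite.unop_zero, LinearMap.zero_apply, map_zero, map_zero, map_zero]
    exact ⟨rfl, map_zero _⟩
  | mul x y _ _ hx hy =>
    intro z hz
    obtain ⟨h1, h2⟩ := hx z hz
    obtain ⟨h3, h4⟩ := hy _ h1
    refine ⟨h3, ?_⟩
    rw [← mul_assoc, ← h2, ← h4, MulOpposite.unop_mul, Module.End.mul_apply]
  | smul r x _ hx =>
    intro z hz
    obtain ⟨h1, h2⟩ := hx z hz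
    rw [MulOpposite.unop_smul, LinearMap.smul_apply, map_smul, map_smul, map_smul, h1,
      mul_smul_comm, ← h2]
    exact ⟨smul_zero _, map_smul _ _ _⟩

theorem vIdentities_le_idealSpan {S : Set (Free F)} (hS : tIdeal S = identities F (P F n)) {d : ℕ}
    (hd : ∀ s ∈ S, ∀ φ : Free F →ₙₐ[F] Model (vForm F),
      φ s ∈ ideal (vForm F) (idealE1 (boundedVIdentities F n d))) :
    vIdentities F (P F n) ≤ idealSpan (boundedVIdentities F n d) := by
  intro f hf
  obtain ⟨g, hg⟩ := RelFree.proj_surjective _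
    ((f : RightOp F).unop (RelFree.gen (definingIdentities F) 0))
  have hgT : g ∈ tIdeal S := by
    rw [hS]
    intro φ
    rw [← descend_proj P.inVariety φ g, hg]
    exact hf _ _
  -- Under $x_i\mapsto x_i+1$ the $X$-components serve as the variables of `f` and the $1$ serves as
  -- its argument, so it does no harm if $x_0$ also occurs in `f`.
  let φ : Free F →ₙₐ[F] Model (vForm F) :=
    evalHom (vForm F) (fun i => Finsupp.single i 1) fun _ => (1, 0)
  have hφ := map_mem_of_mem_tIdeal (ideal (vForm F) (idealE1 (boundedVIdentities F n d)))
    (ideal_mul_left (v := vForm F) mul_vForm_mem_idealE1)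
    (fun a x hx => ideal_mul_right a x hx) hd hgT φ
  let ψ := descend (Model.inVariety vForm_self) φ
  have hgen : ∀ i, ψ (RelFree.gen _ i) = mk (vForm F) (Finsupp.single i 1) 1 0 := fun i => by
    rw [descend_gen, evalHom_of]
  have h := (parts_map_apply ψ (fun i => by rw [hgen, xPart_mk]) f.2 (RelFree.gen _ 0)
    (by rw [hgen, tPart_mk])).2
  rw [← hg, hgen, aPart_mk, descend_proj, map_one, one_mul] at h
  obtain ⟨g', hg', e⟩ := mem_idealE1.1 (mem_ideal.1 hφ).2.1
  rwa [← Subtype.ext (e.trans h)]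

end Main

end MetabelianRS

end

/-- If `P_n`, `n ≥ 2`, has a finite basis of identities, then the ideal of its `V`-identities in
`E₀` is generated by polynomials of bounded degree. -/
theorem mainTheorem4 {F : Type*} [Field F] (n : ℕ) (hn : 2 ≤ n)
    (hP : MetabelianRS.HasFiniteBasis F (MetabelianRS.P F n)) :
    ∃ (d : ℕ) (G : Set (MetabelianRS.E0 F)),
      (∀ g ∈ G, MetabelianRS.DegreeLE d g) ∧
      MetabelianRS.idealSpan G = MetabelianRS.vIdentities F (MetabelianRS.P F n) := by
  obtain ⟨S, hfin, hS⟩ := hP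
  have hbound : ∀ s : S, ∃ N, ∀ d, N ≤ d →
      ∀ φ : MetabelianRS.Free F →ₙₐ[F] MetabelianRS.Model (MetabelianRS.vForm F), φ s ∈
        MetabelianRS.Model.ideal (MetabelianRS.vForm F)
          (MetabelianRS.idealE1 (MetabelianRS.boundedVIdentities F n d)) := fun s =>
    MetabelianRS.exists_bound_map_mem_ideal (by omega) (hS ▸
      Submodule.mem_sInf.2 fun _ hI => hI.2 s.2)
  choose N hN using hbound
  have := hfin.to_subtype
  -- Finiteness of the basis gives one degree that works for all its members.
  obtain ⟨d, hd⟩ := (Set.finite_range N).bddAbove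
  refine ⟨d, MetabelianRS.boundedVIdentities F n d, fun g hg => hg.2,
    le_antisymm (MetabelianRS.idealSpan_boundedVIdentities_le d)
      (MetabelianRS.vIdentities_le_idealSpan hS fun s hs φ => ?_)⟩
  exact hN ⟨s, hs⟩ d (hd (Set.mem_range_self _)) φ
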